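/- Let $M$ be a smooth ($C^\infty$, Hausdorff) manifold of dimension $m=p+q$, let $\mathcal F$ be a smooth foliation of $M$ by $p$-dimensional leaves, let $T^{big}M=TM\oplus T^*M$, and let $E\subseteq T^{big}M$ be a smooth vector subbundle of rank $k$. For an open set $U\subseteq M$, a quotient manifold $Q_U=U/(\mathcal F|_U)$ is a $q$-dimensional manifold with a surjective smooth submersion $\pi:U\to Q_U$ whose fibres are the leaves of $\mathcal F|_U$ (so $\ker \pi_*=T\mathcal F$). A vector field $X$ on such a $U$ is projectable if $\pi_*X=V\circ\pi$ for a smooth vector field $V$ on $Q_U$; a $1$-form $\xi$ on $U$ is projectable if $\xi=\pi^*\lambda$ for a smooth $1$-form $\lambda$ on $Q_U$. The subbundle $E$ is called foliated if each point of $M$ has an open neighborhood $U$ with a quotient manifold $\pi:U\to Q_U$ and a smooth subbundle $\Delta_U\subseteq T^{big}Q_U$ such that, for all $x\in U$, $$E_x=\{(X,\pi^*\alpha)\,:\,X\in T_xM,\ \alpha\in T^*_{\pi(x)}Q_U,\ (\pi_*X,\alpha)\in(\Delta_U)_{\pi(x)}\}.$$ Consider the conditions: a) $E\supseteq T\mathcal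 F$, i.e. $(v,0)\in E$ for every $v\in T\mathcal F$; b) each point of $M$ has an open neighborhood $U$ with a quotient manifold $Q_U$ such that $E|_U$ has a basis of smooth cross sections $(X_i,\xi^i)$ $(i=1,\dots,k)$ with projectable vector fields $X_i$ and projectable $1$-forms $\xi^i$; b') every $Y\in\Gamma T\mathcal F$ is an infinitesimal automorphism of $E$, i.e. $(L_YX,L_Y\xi)\in\Gamma E$ for all $(X,\xi)\in\Gamma E$ (where $\Gamma$ denotes smooth global cross sections). Then: 1. $E$ is foliated if and only if a) and b) hold. 2. If $E$ is foliated, then a) and b') hold. 3. If either $p=0$, or $E_x\not\supseteq T_x^*M$ for every $x\in M$ (for $p>0$ this holds in particular whenever a) holds and $E$ is isotropic for the pairing $g((X,\alpha),(Y,\beta))=\tfrac12(\alpha(Y)+\beta(X))$), then $E$ is foliated if and only if a) and b') hold; that is, b) may be replaced by b'). -/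

import Mathlib

open scoped Manifold ContDiff

universe u

namespace BigFol

/-- The model space of `n`-dimensional manifolds. -/
abbrev Model (n : ℕ) : Type := EuclideanSpace ℝ (Fin n)

section Basic

variable (n : ℕ) (M : Type u) [TopologicalSpace M] [ChartedSpace (Model n) M]

/-- A (not necessarily smooth) vector field on the `n`-manifold `M`. -/
abbrev VField : Type u := (x : M) → TangentSpace (𝓡 n) x

/-- The cotangent space `T*ₓM`. -/
abbrev Cotangent {M : Type u} [TopologicalSpace M] [ChartedSpace (Model n) M] (x : M) : Type :=
  TangentSpace (𝓡 n) x →L[ℝ] ℝ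

/-- A (not necessarily smooth) differential 1-form on the `n`-manifold `M`. -/
abbrev OneForm : Type u := (x : M) → Cotangent n x

/-- The fibre `TₓM ⊕ T*ₓM` of the big tangent bundle `T^big M = TM ⊕ T*M`. -/
abbrev TBig {M : Type u} [TopologicalSpace M] [ChartedSpace (Model n) M] (x : M) : Type :=
  TangentSpace (𝓡 n) x × Cotangent n x

variable {n M} [IsManifold (𝓡 n) ∞ M]

/-- `X` is a smooth vector field on the set `U`. -/
def SmoothVFieldOn (X : VField n M) (U : Set M) : Prop :=
  ContMDiffOn (𝓡 n) (𝓡 n).tangent ∞ (fun x => (⟨x, X x⟩ : TangentBundle (𝓡 n) M)) U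

/-- `ξ` is a smooth 1-form on the set `U`: a smooth section of the bundle of continuous linear
maps from the tangent bundle to the trivial line bundle. -/
def SmoothOneFormOn (ξ : OneForm n M) (U : Set M) : Prop :=
  ContMDiffOn (𝓡 n) ((𝓡 n).prod 𝓘(ℝ, Model n →L[ℝ] ℝ)) ∞
    (fun x => Bundle.TotalSpace.mk' (Model n →L[ℝ] ℝ)
      (E := fun y : M => TangentSpace (𝓡 n) y →L[ℝ] Bundle.Trivial M ℝ y) x (ξ x)) U

/-- The Lie derivative `L_Y X = [Y, X]` of a vector field. -/
noncomputable def lieDerivVField (Y X : VField n M) : VField n M :=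
  VectorField.mlieBracket (𝓡 n) Y X

/-- The vector field `Y` in the preferred chart `φ` at `x`, as a map between vector spaces:
`w ↦ (dφ)(Y (φ⁻¹ w))`. -/
noncomputable def localVField (Y : VField n M) (x : M) : Model n → Model n :=
  VectorField.mpullback 𝓘(ℝ, Model n) (𝓡 n) (extChartAt (𝓡 n) x).symm Y

/-- The 1-form `ξ` in the preferred chart `φ` at `x`, as a map between vector spaces:
`w ↦ ξ (φ⁻¹ w) ∘ d(φ⁻¹)_w`. -/
noncomputable def localOneForm (ξ : OneForm n M) (x : M) : Model n → (Model n →L[ℝ] ℝ) :=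
  fun w => (ξ ((extChartAt (𝓡 n) x).symm w)).comp
    (mfderiv 𝓘(ℝ, Model n) (𝓡 n) (extChartAt (𝓡 n) x).symm w)

/-- The Lie derivative `L_Y ξ` of a 1-form, through the coordinate formula
`(L_Y ξ)_j = Y^i ∂_i ξ_j + ξ_i ∂_j Y^i` in the preferred chart at each point. -/
noncomputable def lieDerivOneForm (Y : VField n M) (ξ : OneForm n M) : OneForm n M := fun x =>
  let w : Model n := extChartAt (𝓡 n) x x
  let L : Model n →L[ℝ] ℝ :=
    fderiv ℝ (localOneForm ξ x) w (localVField Y x w)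
      + (localOneForm ξ x w).comp (fderiv ℝ (localVField Y x) w)
  L.comp (mfderiv (𝓡 n) 𝓘(ℝ, Model n) (extChartAt (𝓡 n) x) x)

/-- The pairs `(X i, ξ i)` form a smooth frame over `U` of the field of subspaces `E`. -/
structure IsFrameOn (E : (x : M) → Submodule ℝ (TBig n x)) (U : Set M) {k : ℕ}
    (X : Fin k → VField n M) (ξ : Fin k → OneForm n M) : Prop where
  smooth_fst : ∀ i, SmoothVFieldOn (X i) U
  smooth_snd : ∀ i, SmoothOneFormOn (ξ i) U
  linearIndependent : ∀ x ∈ U, LinearIndependent ℝ (fun i => ((X i x, ξ i x) : TBig n x))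
  span_eq : ∀ x ∈ U, Submodule.span ℝ (Set.range fun i => ((X i x, ξ i x) : TBig n x)) = E x

variable (n M)

/-- A smooth vector subbundle of rank `k` of the big tangent bundle `T^big M`. -/
structure BigSubbundle (k : ℕ) where
  /-- the fibre over `x` -/
  fiber : (x : M) → Submodule ℝ (TBig n x)
  exists_frame : ∀ x : M, ∃ U : Set M, IsOpen U ∧ x ∈ U ∧
    ∃ (X : Fin k → VField n M) (ξ : Fin k → OneForm n M), IsFrameOn fiber U X ξ

variable {n M}

/-- `(X, ξ)` is a global smooth cross section of `E`. -/
structure BigSubbundle.IsSection {k : ℕ} (E : BigSubbundle n M k)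
    (X : VField n M) (ξ : OneForm n M) : Prop where
  smooth_fst : SmoothVFieldOn X Set.univ
  smooth_snd : SmoothOneFormOn ξ Set.univ
  mem : ∀ x, (X x, ξ x) ∈ E.fiber x

end Basic

section Fol

variable (p q : ℕ) (M : Type u) [TopologicalSpace M] [ChartedSpace (Model (p + q)) M]
  [IsManifold (𝓡 (p + q)) ∞ M]

/-- A smooth foliation by `p`-dimensional leaves of a `(p + q)`-dimensional manifold, given by its
tangent spaces: around each point there is a smooth chart `(z¹, …, zᵖ, y¹, …, y^q)` in which the
foliation has the equations `dy¹ = ⋯ = dy^q = 0`. -/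
structure Foliation where
  /-- the tangent space of the leaf through `x` -/
  tangent : (x : M) → Submodule ℝ (TangentSpace (𝓡 (p + q)) x)
  exists_chart : ∀ x₀ : M, ∃ e ∈ IsManifold.maximalAtlas (𝓡 (p + q)) ∞ M, x₀ ∈ e.source ∧
    ∀ x ∈ e.source, ∀ v : TangentSpace (𝓡 (p + q)) x,
      v ∈ tangent x ↔ ∀ j : Fin q,
        EuclideanSpace.proj (𝕜 := ℝ) (Fin.natAdd p j)
          (mfderiv (𝓡 (p + q)) (𝓡 (p + q)) e x v) = 0

variable {p q M}

/-- `x` and `y` are the endpoints of a smooth curve in `U` that is tangent to the foliation. -/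
def LeafCurve (F : Foliation p q M) (U : Set M) (x y : M) : Prop :=
  ∃ γ : ℝ → M, γ 0 = x ∧ γ 1 = y ∧ ∀ t ∈ Set.Icc (0 : ℝ) 1,
    ContMDiffAt 𝓘(ℝ, ℝ) (𝓡 (p + q)) ∞ γ t ∧ γ t ∈ U ∧
      mfderiv 𝓘(ℝ, ℝ) (𝓡 (p + q)) γ t (1 : ℝ) ∈ F.tangent (γ t)

/-- `x` and `y` lie on the same leaf of the restricted foliation `F|_U`: they can be joined by a
piecewise smooth curve in `U` that is tangent to the foliation. -/
def SameLeaf (F : Foliation p q M) (U : Set M) : M → M → Prop :=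
  Relation.EqvGen (LeafCurve F U)

/-- `π : U → Q` exhibits the `q`-manifold `Q` as the quotient manifold `U / (F|_U)` (only the
values of `π` on the open set `U` matter): `π` is a smooth submersion of `U` onto `Q`, its fibres
in `U` are the leaves of `F|_U`, and the kernel of its differential is the tangent space of the
leaf. -/
structure IsLeafSpace (F : Foliation p q M) (U : Set M) {Q : Type u} [TopologicalSpace Q]
    [ChartedSpace (Model q) Q] (π : M → Q) : Prop where
  isOpen : IsOpen U
  smooth : ContMDiffOn (𝓡 (p + q)) (𝓡 q) ∞ π U
  surjOn : Set.SurjOn π U Set.univ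
  submersion : ∀ x ∈ U, Function.Surjective (mfderiv (𝓡 (p + q)) (𝓡 q) π x)
  ker_eq : ∀ x ∈ U, ∀ v : TangentSpace (𝓡 (p + q)) x,
    mfderiv (𝓡 (p + q)) (𝓡 q) π x v = 0 ↔ v ∈ F.tangent x
  fiber_eq : ∀ x ∈ U, ∀ y ∈ U, π x = π y ↔ SameLeaf F U x y

/-- The vector field `X` on `U` projects to a smooth vector field on `Q`. -/
def ProjectableVField (U : Set M) {Q : Type u} [TopologicalSpace Q] [ChartedSpace (Model q) Q]
    [IsManifold (𝓡 q) ∞ Q] (π : M → Q) (X : VField (p + q) M) : Prop :=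
  ∃ V : VField q Q, SmoothVFieldOn V Set.univ ∧
    ∀ x ∈ U, mfderiv (𝓡 (p + q)) (𝓡 q) π x (X x) = V (π x)

/-- The 1-form `ξ` on `U` is the pullback of a smooth 1-form on `Q`. -/
def ProjectableOneForm (U : Set M) {Q : Type u} [TopologicalSpace Q] [ChartedSpace (Model q) Q]
    [IsManifold (𝓡 q) ∞ Q] (π : M → Q) (ξ : OneForm (p + q) M) : Prop :=
  ∃ μ : OneForm q Q, SmoothOneFormOn μ Set.univ ∧
    ∀ x ∈ U, ξ x = (μ (π x)).comp (mfderiv (𝓡 (p + q)) (𝓡 q) π x)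

variable {k : ℕ}

/-- `E` is foliated (projectable): each point has an open neighbourhood `U` with a quotient
manifold `π : U → Q = U / (F|_U)` and a subbundle `Δ` of `T^big Q` such that
`E_x = {(X, π*α) | X ∈ TₓM, (π_* X, α) ∈ Δ_{π(x)}}` for all `x ∈ U`. -/
def BigSubbundle.IsFoliated (E : BigSubbundle (p + q) M k) (F : Foliation p q M) : Prop :=
  ∀ x₀ : M, ∃ U : Set M, IsOpen U ∧ x₀ ∈ U ∧
    ∃ (Q : Type u) (_ : TopologicalSpace Q) (_ : T2Space Q) (_ : ChartedSpace (Model q) Q)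
      (_ : IsManifold (𝓡 q) ∞ Q) (π : M → Q), IsLeafSpace F U π ∧
      ∃ (l : ℕ) (Δ : BigSubbundle q Q l), ∀ x ∈ U, ∀ w : TBig (p + q) x,
        w ∈ E.fiber x ↔ ∃ α : Cotangent q (π x),
          ((mfderiv (𝓡 (p + q)) (𝓡 q) π x w.1, α) : TBig q (π x)) ∈ Δ.fiber (π x) ∧
            w.2 = α.comp (mfderiv (𝓡 (p + q)) (𝓡 q) π x)

/-- `E` contains the tangent bundle of the foliation (embedded as `v ↦ (v, 0)`). -/
def BigSubbundle.ContainsTangent (E : BigSubbundle (p + q) M k) (F : Foliation p q M) : Prop :=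
  ∀ x : M, ∀ v ∈ F.tangent x, ((v, 0) : TBig (p + q) x) ∈ E.fiber x

/-- Each point has an open neighbourhood over which `E` has a basis of cross sections `(X i, ξ i)`
with projectable vector fields `X i` and projectable 1-forms `ξ i`. -/
def BigSubbundle.HasProjectableBases (E : BigSubbundle (p + q) M k) (F : Foliation p q M) : Prop :=
  ∀ x₀ : M, ∃ U : Set M, IsOpen U ∧ x₀ ∈ U ∧
    ∃ (Q : Type u) (_ : TopologicalSpace Q) (_ : T2Space Q) (_ : ChartedSpace (Model q) Q)
      (_ : IsManifold (𝓡 q) ∞ Q) (π : M → Q), IsLeafSpace F U π ∧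
      ∃ (X : Fin k → VField (p + q) M) (ξ : Fin k → OneForm (p + q) M),
        IsFrameOn E.fiber U X ξ ∧
          ∀ i, ProjectableVField U π (X i) ∧ ProjectableOneForm U π (ξ i)

/-- Every smooth global section `Y` of the tangent bundle of the foliation is an infinitesimal
automorphism of `E`: `(L_Y X, L_Y ξ) ∈ ΓE` for all `(X, ξ) ∈ ΓE`. -/
def BigSubbundle.TangentPreserves (E : BigSubbundle (p + q) M k) (F : Foliation p q M) : Prop :=
  ∀ Y : VField (p + q) M, SmoothVFieldOn Y Set.univ → (∀ x, Y x ∈ F.tangent x) →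
    ∀ (X : VField (p + q) M) (ξ : OneForm (p + q) M), E.IsSection X ξ →
      E.IsSection (lieDerivVField Y X) (lieDerivOneForm Y ξ)

end Fol

end BigFol

/-! Everything passes through one local normal form. Call a chart onto all of `ℝ^(p+q)` foliated if
the leaves are the fibres of the projection onto the last `q` coordinates; a vector killed by that
projection is vertical. A foliated chart is adapted to `E` if, in coordinates, (i) `E` contains
every `(v, 0)` with `v` vertical, (ii) the covector part of every element of `E` kills the vertical
vectors, and (iii) the fibre of `E` does not change under vertical translation. Each side of each
equivalence is compared with the existence of small adapted charts around every point
(`HasAdaptedCharts`).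

Adapted charts give everything. By (iii), a local frame may be replaced by its values on the
transversal where the first `p` coordinates vanish; it is then projectable, with (ii) making the
1-forms pullbacks. By (i) and (ii), a fibre is recovered from its transverse part, whose dimension
is constant, so that the transverse parts form the bundle `Δ` on `ℝ^q`. Finally, for `Y` tangent to
the leaves, the Lie derivative of a section `(X, ξ)` is its derivative along `Y`, which lies in `E`
by (iii), up to a vertical vector and a term `ξ ∘ dY` that vanishes by (ii).

Conversely, if `E` is foliated, or has projectable bases and contains the tangent bundle of the
foliation, the conditions follow because the quotient map and its differential are constant along
the plaques of a foliated chart.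

The main point is the passage from a) and b') to adapted charts
(`BigSubbundle.TangentPreserves.hasAdaptedCharts`). For a constant vertical `v`, a function `f` and
a frame element `B = (X, ξ)`, invariance under `Y = f v` says `f ∂_v B + (-df(X) v, ξ(v) df) ∈ E`.
If `ξ(v) ≠ 0` at `w`, functions `f` vanishing at `w` with arbitrary differential put the whole
cotangent space in `E`, against the hypothesis; this is (ii). The choice `f = 1` gives `∂_v B ∈ E`,
and a Grönwall estimate (`span_le_of_deriv_mem_span`) turns this into (iii). Since b') concerns
global sections only, fields are cut off in the chart and extended by zero, which uses that `M` is
Hausdorff. -/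

namespace BigFol

/-! ### Vector fields and 1-forms read in a chart of the maximal atlas. -/

section Charts

variable {n : ℕ} {M : Type u} [TopologicalSpace M] [ChartedSpace (Model n) M]

/-- The differential of a chart, as a map of the model space. -/
noncomputable def chartDeriv (e : OpenPartialHomeomorph M (Model n)) (x : M) :
    Model n →L[ℝ] Model n :=
  mfderiv (𝓡 n) (𝓡 n) e x

/-- The differential of the inverse of a chart, as a map of the model space. -/
noncomputable def chartSymmDeriv (e : OpenPartialHomeomorph M (Model n)) (w : Model n) :
    Model n →L[ℝ] Model n :=
  mfderiv (𝓡 n) (𝓡 n) e.symm w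

/-- The vector field `X` read in the chart `e`. -/
noncomputable def chartVField (e : OpenPartialHomeomorph M (Model n)) (X : VField n M) :
    Model n → Model n :=
  fun w => chartDeriv e (e.symm w) (X (e.symm w))

/-- The 1-form `ξ` read in the chart `e`. -/
noncomputable def chartOneForm (e : OpenPartialHomeomorph M (Model n)) (ξ : OneForm n M) :
    Model n → (Model n →L[ℝ] ℝ) :=
  fun w => (show Model n →L[ℝ] ℝ from ξ (e.symm w)).comp (chartSymmDeriv e w)

variable {e : OpenPartialHomeomorph M (Model n)}

theorem mdifferentiable_of_mem_maximalAtlas (he : e ∈ IsManifold.maximalAtlas (𝓡 n) ∞ M) :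
    e.MDifferentiable (𝓡 n) (𝓡 n) :=
  ⟨(contMDiffOn_of_mem_maximalAtlas he).mdifferentiableOn (by simp),
    (contMDiffOn_symm_of_mem_maximalAtlas he).mdifferentiableOn (by simp)⟩

theorem contMDiffAt_chart (he : e ∈ IsManifold.maximalAtlas (𝓡 n) ∞ M) {x : M}
    (hx : x ∈ e.source) : ContMDiffAt (𝓡 n) (𝓡 n) ∞ e x :=
  (contMDiffOn_of_mem_maximalAtlas he).contMDiffAt (e.open_source.mem_nhds hx)

theorem contMDiffAt_chart_symm (he : e ∈ IsManifold.maximalAtlas (𝓡 n) ∞ M) {w : Model n}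
    (hw : w ∈ e.target) : ContMDiffAt (𝓡 n) (𝓡 n) ∞ e.symm w :=
  (contMDiffOn_symm_of_mem_maximalAtlas he).contMDiffAt (e.open_target.mem_nhds hw)

theorem chartSymmDeriv_comp (he : e ∈ IsManifold.maximalAtlas (𝓡 n) ∞ M) {x : M}
    (hx : x ∈ e.source) :
    (chartSymmDeriv e (e x)).comp (chartDeriv e x) = ContinuousLinearMap.id ℝ (Model n) :=
  (mdifferentiable_of_mem_maximalAtlas he).symm_comp_deriv hx

theorem chartSymmDeriv_chartDeriv (he : e ∈ IsManifold.maximalAtlas (𝓡 n) ∞ M) {x : M}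
    (hx : x ∈ e.source) (v : Model n) : chartSymmDeriv e (e x) (chartDeriv e x v) = v :=
  congrArg (fun L : Model n →L[ℝ] Model n => L v) (chartSymmDeriv_comp he hx)

theorem chartDeriv_comp (he : e ∈ IsManifold.maximalAtlas (𝓡 n) ∞ M) {w : Model n}
    (hw : w ∈ e.target) :
    (chartDeriv e (e.symm w)).comp (chartSymmDeriv e w) = ContinuousLinearMap.id ℝ (Model n) :=
  (mdifferentiable_of_mem_maximalAtlas he).comp_symm_deriv hw

theorem chartDeriv_chartSymmDeriv (he : e ∈ IsManifold.maximalAtlas (𝓡 n) ∞ M) {w : Model n}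
    (hw : w ∈ e.target) (v : Model n) : chartDeriv e (e.symm w) (chartSymmDeriv e w v) = v :=
  congrArg (fun L : Model n →L[ℝ] Model n => L v) (chartDeriv_comp he hw)

theorem chartSymmDeriv_chartVField (he : e ∈ IsManifold.maximalAtlas (𝓡 n) ∞ M) {w : Model n}
    (hw : w ∈ e.target) (X : VField n M) :
    chartSymmDeriv e w (chartVField e X w) = X (e.symm w) := by
  have := chartSymmDeriv_chartDeriv he (e.map_target hw) (X (e.symm w))
  rwa [e.right_inv hw] at this

theorem chartVField_apply {x : M} (hx : x ∈ e.source) (X : VField n M) :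
    chartVField e X (e x) = chartDeriv e x (X x) := by
  have h : ∀ y, y = x → chartDeriv e y (X y) = chartDeriv e x (X x) := by
    rintro _ rfl
    rfl
  exact h _ (e.left_inv hx)

theorem chartOneForm_comp (he : e ∈ IsManifold.maximalAtlas (𝓡 n) ∞ M) {w : Model n}
    (hw : w ∈ e.target) (ξ : OneForm n M) :
    (chartOneForm e ξ w).comp (chartDeriv e (e.symm w)) = ξ (e.symm w) := by
  have := chartSymmDeriv_comp he (e.map_target hw)
  rw [e.right_inv hw] at this
  rw [chartOneForm, ContinuousLinearMap.comp_assoc, this]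
  rfl

/-- The differential of a chart as a continuous linear equivalence. -/
noncomputable def chartDerivEquiv (he : e ∈ IsManifold.maximalAtlas (𝓡 n) ∞ M) {x : M}
    (hx : x ∈ e.source) : Model n ≃L[ℝ] Model n :=
  ContinuousLinearEquiv.equivOfInverse (chartDeriv e x) (chartSymmDeriv e (e x))
    (chartSymmDeriv_chartDeriv he hx)
    (fun v => by
      have := chartDeriv_chartSymmDeriv he (e.map_source hx) v
      rwa [e.left_inv hx] at this)

theorem mpullback_chart_symm (he : e ∈ IsManifold.maximalAtlas (𝓡 n) ∞ M) {w : Model n}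
    (hw : w ∈ e.target) (X : VField n M) :
    VectorField.mpullback (𝓡 n) (𝓡 n) e.symm X w = chartVField e X w := by
  have hx := e.map_target hw
  have h : mfderiv (𝓡 n) (𝓡 n) e.symm w = ((chartDerivEquiv he hx).symm : Model n →L[ℝ] Model n) := by
    change chartSymmDeriv e w = chartSymmDeriv e (e (e.symm w))
    rw [e.right_inv hw]
  rw [VectorField.mpullback_apply]
  refine (congrArg (fun L : Model n →L[ℝ] Model n => L.inverse (X (e.symm w))) h).trans ?_
  rw [ContinuousLinearMap.inverse_equiv]
  rfl

theorem isInvertible_chart (he : e ∈ IsManifold.maximalAtlas (𝓡 n) ∞ M) {x : M}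
    (hx : x ∈ e.source) : (mfderiv (𝓡 n) (𝓡 n) e x).IsInvertible :=
  ⟨chartDerivEquiv he hx, rfl⟩

theorem isInvertible_chart_symm (he : e ∈ IsManifold.maximalAtlas (𝓡 n) ∞ M) {w : Model n}
    (hw : w ∈ e.target) : (mfderiv (𝓡 n) (𝓡 n) e.symm w).IsInvertible := by
  refine ⟨(chartDerivEquiv he (e.map_target hw)).symm, ?_⟩
  change chartSymmDeriv e (e (e.symm w)) = chartSymmDeriv e w
  rw [e.right_inv hw]

/-- Smoothness at a point of a vector field, in terms of a vector field read in a chart. -/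
theorem contMDiffAt_vField_iff [IsManifold (𝓡 n) ∞ M] (he : e ∈ IsManifold.maximalAtlas (𝓡 n) ∞ M) {x : M}
    (hx : x ∈ e.source) (X : VField n M) :
    ContMDiffAt (𝓡 n) (𝓡 n).tangent ∞ (fun x => (⟨x, X x⟩ : TangentBundle (𝓡 n) M)) x ↔
      ContDiffAt ℝ ∞ (chartVField e X) (e x) := by
  have hM : IsManifold (𝓡 n) 1 M := IsManifold.of_le (n := ∞) (by simp)
  have hw := e.map_source hx
  constructor
  · intro h
    rw [← e.left_inv hx] at h
    have h2 := h.mpullback_vectorField_preimage (contMDiffAt_chart_symm he hw)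
      (isInvertible_chart_symm he hw) (by simp)
    rw [contMDiffAt_vectorSpace_iff_contDiffAt] at h2
    refine h2.congr_of_eventuallyEq ?_
    filter_upwards [e.open_target.mem_nhds hw] with w hw
    exact (mpullback_chart_symm he hw X).symm
  · intro h
    rw [← contMDiffAt_vectorSpace_iff_contDiffAt (V := chartVField e X)] at h
    have h2 := h.mpullback_vectorField_preimage (contMDiffAt_chart he hx)
      (isInvertible_chart he hx) (by simp)
    refine h2.congr_of_eventuallyEq ?_
    filter_upwards [e.open_source.mem_nhds hx] with y hy
    refine congrArg (Bundle.TotalSpace.mk y) ?_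
    have h3 : mfderiv (𝓡 n) (𝓡 n) e y = (chartDerivEquiv he hy : Model n →L[ℝ] Model n) := rfl
    refine Eq.symm ((congrArg
      (fun L : Model n →L[ℝ] Model n => L.inverse (chartVField e X (e y))) h3).trans ?_)
    rw [ContinuousLinearMap.inverse_equiv]
    change chartSymmDeriv e (e y) (chartVField e X (e y)) = X y
    rw [chartSymmDeriv_chartVField he (e.map_source hy), e.left_inv hy]

theorem contMDiffAt_iff_comp_chart_symm {G : Type*} [NormedAddCommGroup G] [NormedSpace ℝ G]
    (he : e ∈ IsManifold.maximalAtlas (𝓡 n) ∞ M) {x : M} (hx : x ∈ e.source) (g : M → G) :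
    ContMDiffAt (𝓡 n) 𝓘(ℝ, G) ∞ g x ↔ ContDiffAt ℝ ∞ (g ∘ e.symm) (e x) := by
  constructor
  · intro h
    rw [← e.left_inv hx] at h
    exact (h.comp (e x) (contMDiffAt_chart_symm he (e.map_source hx))).contDiffAt
  · intro h
    refine (h.contMDiffAt.comp x (contMDiffAt_chart he hx)).congr_of_eventuallyEq ?_
    filter_upwards [e.open_source.mem_nhds hx] with y hy
    simp [e.left_inv hy]

/-- In finite dimension, a linear map is the image of its values on a basis under a fixed continuous
linear map. -/
theorem contDiffAt_clm_iff {D E' G : Type*} [NormedAddCommGroup D] [NormedSpace ℝ D]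
    [NormedAddCommGroup E'] [NormedSpace ℝ E'] [FiniteDimensional ℝ E']
    [NormedAddCommGroup G] [NormedSpace ℝ G] {f : D → E' →L[ℝ] G} {x : D} :
    ContDiffAt ℝ ∞ f x ↔ ∀ v, ContDiffAt ℝ ∞ (fun y => f y v) x := by
  constructor
  · intro h v
    exact h.clm_apply contDiffAt_const
  · intro h
    let b := Module.finBasis ℝ E'
    let C : (Fin (Module.finrank ℝ E') → G) →L[ℝ] (E' →L[ℝ] G) :=
      ∑ i, (ContinuousLinearMap.smulRightL ℝ E' G
        (LinearMap.toContinuousLinearMap (b.coord i))).comp (ContinuousLinearMap.proj i)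
    have hf : f = fun y => C (fun i => f y (b i)) := by
      funext y
      refine ContinuousLinearMap.coe_injective (b.ext fun j => ?_)
      simp [C, Finsupp.single_apply]
    rw [hf]
    exact C.contDiff.contDiffAt.comp x (contDiffAt_pi.2 fun i => h (b i))

variable [IsManifold (𝓡 n) ∞ M]

/-- The function `x ↦ ξ x (Z x)` is smooth at a point where `ξ` and `Z` are. -/
theorem contMDiffAt_oneForm_apply {x : M} {ξ : OneForm n M} {Z : VField n M}
    (hξ : ContMDiffAt (𝓡 n) ((𝓡 n).prod 𝓘(ℝ, Model n →L[ℝ] ℝ)) ∞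
      (fun x => Bundle.TotalSpace.mk' (Model n →L[ℝ] ℝ)
        (E := fun y : M => TangentSpace (𝓡 n) y →L[ℝ] Bundle.Trivial M ℝ y) x (ξ x)) x)
    (hZ : ContMDiffAt (𝓡 n) (𝓡 n).tangent ∞ (fun x => (⟨x, Z x⟩ : TangentBundle (𝓡 n) M)) x) :
    ContMDiffAt (𝓡 n) 𝓘(ℝ, ℝ) ∞ (fun x => (ξ x (Z x) : ℝ)) x := by
  have h := ContMDiffAt.clm_bundle_apply (E₁ := (TangentSpace (𝓡 n) : M → Type _))
    (E₂ := Bundle.Trivial M ℝ) (b := id) hξ hZ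
  exact (Bundle.contMDiffAt_totalSpace.1 h).2

/-- The component of `ξ` along a constant vector in a trivialization of the tangent bundle is `ξ`
applied to the corresponding smooth local vector field. -/
theorem contMDiffAt_oneForm_of_apply {x : M} {ξ : OneForm n M}
    (he : e ∈ IsManifold.maximalAtlas (𝓡 n) ∞ M) (hx : x ∈ e.source)
    (h : ∀ Z : VField n M,
      ContMDiffAt (𝓡 n) (𝓡 n).tangent ∞ (fun x => (⟨x, Z x⟩ : TangentBundle (𝓡 n) M)) x →
        ContMDiffAt (𝓡 n) 𝓘(ℝ, ℝ) ∞ (fun x => (ξ x (Z x) : ℝ)) x) :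
    ContMDiffAt (𝓡 n) ((𝓡 n).prod 𝓘(ℝ, Model n →L[ℝ] ℝ)) ∞
      (fun x => Bundle.TotalSpace.mk' (Model n →L[ℝ] ℝ)
        (E := fun y : M => TangentSpace (𝓡 n) y →L[ℝ] Bundle.Trivial M ℝ y) x (ξ x)) x := by
  rw [contMDiffAt_hom_bundle]
  refine ⟨contMDiffAt_id, ?_⟩
  refine (contMDiffAt_iff_comp_chart_symm he hx _).2 (contDiffAt_clm_iff.2 fun v => ?_)
  refine (contMDiffAt_iff_comp_chart_symm he hx (fun y : M =>
    (ContinuousLinearMap.inCoordinates (Model n) (TangentSpace (𝓡 n)) ℝ (Bundle.Trivial M ℝ)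
      x y x y (ξ y)) v)).1 ?_
  let t := trivializationAt (Model n) (TangentSpace (𝓡 n) : M → Type _) x
  have hxt : x ∈ t.baseSet := FiberBundle.mem_baseSet_trivializationAt' x
  have hM : IsManifold (𝓡 n) (∞ + 1) M := by simpa using ‹IsManifold (𝓡 n) ∞ M›
  have hZ : ContMDiffAt (𝓡 n) (𝓡 n).tangent ∞
      (fun y => (⟨y, t.symmL ℝ y v⟩ : TangentBundle (𝓡 n) M)) x :=
    ContMDiffAt.clm_bundle_apply (E₁ := Bundle.Trivial M (Model n))
      (E₂ := (TangentSpace (𝓡 n) : M → Type _)) (b := id)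
      (t.contMDiffAt_symmL (n := ∞) hxt)
      (Bundle.contMDiffAt_totalSpace.2 ⟨contMDiffAt_id, contMDiffAt_const⟩)
  refine (h _ hZ).congr_of_eventuallyEq ?_
  filter_upwards [t.open_baseSet.mem_nhds hxt] with y hy
  rw [ContinuousLinearMap.inCoordinates_eq hy (by trivial)]
  have h1 (a : ℝ) : (trivializationAt ℝ (Bundle.Trivial M ℝ) x).continuousLinearEquivAt ℝ y
      trivial a = a := rfl
  have h2 : (t.continuousLinearEquivAt ℝ y hy).symm v = t.symmL ℝ y v :=
    congrFun (t.symm_continuousLinearEquivAt_eq hy) v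
  exact (h1 _).trans (congrArg (ξ y) h2)

/-- Smoothness at a point of a 1-form, in terms of the 1-form read in a chart. -/
theorem contMDiffAt_oneForm_iff (he : e ∈ IsManifold.maximalAtlas (𝓡 n) ∞ M) {x : M}
    (hx : x ∈ e.source) (ξ : OneForm n M) :
    ContMDiffAt (𝓡 n) ((𝓡 n).prod 𝓘(ℝ, Model n →L[ℝ] ℝ)) ∞
      (fun x => Bundle.TotalSpace.mk' (Model n →L[ℝ] ℝ)
        (E := fun y : M => TangentSpace (𝓡 n) y →L[ℝ] Bundle.Trivial M ℝ y) x (ξ x)) x ↔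
      ContDiffAt ℝ ∞ (chartOneForm e ξ) (e x) := by
  have hw := e.map_source hx
  constructor
  · intro h
    refine contDiffAt_clm_iff.2 fun v => ?_
    -- This is the field equal to the constant `v` in the chart; pairing with it extracts a
    -- component of `ξ`.
    have hZ : ContMDiffAt (𝓡 n) (𝓡 n).tangent ∞
        (fun y => (⟨y, (chartSymmDeriv e (e y) v : Model n)⟩ : TangentBundle (𝓡 n) M)) x := by
      refine (contMDiffAt_vField_iff he hx _).2
        ((contDiffAt_const (c := v)).congr_of_eventuallyEq ?_)
      filter_upwards [e.open_target.mem_nhds hw] with w hw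
      change chartDeriv e (e.symm w) (chartSymmDeriv e (e (e.symm w)) v) = v
      rw [e.right_inv hw]
      exact chartDeriv_chartSymmDeriv he hw v
    refine ((contMDiffAt_iff_comp_chart_symm he hx _).1
      (contMDiffAt_oneForm_apply h hZ)).congr_of_eventuallyEq ?_
    filter_upwards [e.open_target.mem_nhds hw] with w hw
    simp only [Function.comp_apply, e.right_inv hw]
    rfl
  · intro h
    refine contMDiffAt_oneForm_of_apply he hx fun Z hZ => ?_
    refine (contMDiffAt_iff_comp_chart_symm he hx _).2 ((h.clm_apply
      ((contMDiffAt_vField_iff he hx Z).1 hZ)).congr_of_eventuallyEq ?_)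
    filter_upwards [e.open_target.mem_nhds hw] with w hw
    change _ = (show Model n →L[ℝ] ℝ from ξ (e.symm w)) (chartSymmDeriv e w (chartVField e Z w))
    rw [chartSymmDeriv_chartVField he hw]
    rfl

end Charts

/-! ### The Lie derivative of 1-forms on a vector space and its naturality. -/

open Filter Topology

/-- The Lie derivative of a 1-form on a vector space. -/
noncomputable def flatLieOneForm {V : Type*} [NormedAddCommGroup V] [NormedSpace ℝ V]
    (Y : V → V) (ξ : V → (V →L[ℝ] ℝ)) (w : V) : V →L[ℝ] ℝ :=
  fderiv ℝ ξ w (Y w) + (ξ w).comp (fderiv ℝ Y w)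

theorem flatLieOneForm_congr {V : Type*} [NormedAddCommGroup V] [NormedSpace ℝ V]
    {Y Y' : V → V} {ξ ξ' : V → (V →L[ℝ] ℝ)} {w : V} (hY : Y =ᶠ[𝓝 w] Y') (hξ : ξ =ᶠ[𝓝 w] ξ') :
    flatLieOneForm Y ξ w = flatLieOneForm Y' ξ' w := by
  simp only [flatLieOneForm, hY.fderiv_eq, hξ.fderiv_eq, hY.eq_of_nhds, hξ.eq_of_nhds]

/-- The Lie derivative of 1-forms is natural with respect to related vector fields. -/
theorem flatLieOneForm_of_related {V : Type*} [NormedAddCommGroup V] [NormedSpace ℝ V]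
    {φ : V → V} {Y Y' : V → V} {ξ ξ' : V → (V →L[ℝ] ℝ)} {w : V}
    (hφ : ContDiffAt ℝ ∞ φ w) (hY : DifferentiableAt ℝ Y (φ w)) (hY' : DifferentiableAt ℝ Y' w)
    (hξ : DifferentiableAt ℝ ξ (φ w))
    (h1 : ∀ᶠ z in 𝓝 w, fderiv ℝ φ z (Y' z) = Y (φ z))
    (h2 : ∀ᶠ z in 𝓝 w, ξ' z = (ξ (φ z)).comp (fderiv ℝ φ z)) :
    flatLieOneForm Y' ξ' w = (flatLieOneForm Y ξ (φ w)).comp (fderiv ℝ φ w) := by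
  have dφ : DifferentiableAt ℝ φ w := hφ.differentiableAt (by simp)
  have ddφ : DifferentiableAt ℝ (fderiv ℝ φ) w :=
    (hφ.fderiv_right (m := 1) (WithTop.coe_le_coe.2 le_top)).differentiableAt (by simp)
  have hsymm : IsSymmSndFDerivAt ℝ φ w := hφ.isSymmSndFDerivAt (by
    rw [minSmoothness_of_isRCLikeNormedField]; exact WithTop.coe_le_coe.2 le_top)
  have e1 : fderiv ℝ (fun z => fderiv ℝ φ z (Y' z)) w = fderiv ℝ (fun z => Y (φ z)) w :=
    EventuallyEq.fderiv_eq h1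
  have e2 : fderiv ℝ ξ' w = fderiv ℝ (fun z => (ξ (φ z)).comp (fderiv ℝ φ z)) w :=
    EventuallyEq.fderiv_eq h2
  rw [fderiv_clm_apply ddφ hY', fderiv_fun_comp w hY dφ] at e1
  rw [fderiv_clm_comp (c := fun z => ξ (φ z)) (hξ.comp w dφ) ddφ, fderiv_fun_comp w hξ dφ] at e2
  ext v
  have e1v := congrArg (fun L : V →L[ℝ] V => L v) e1
  simp only [add_apply, ContinuousLinearMap.comp_apply,
    ContinuousLinearMap.flip_apply] at e1v
  -- Differentiating `ξ'` produces `D²φ(Y', v)`, while differentiating the relation `Dφ(Y') = Y ∘ φ`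
  -- produces `D²φ(v, Y')`; the symmetry of `D²φ` makes the second-order terms match.
  have hs := hsymm.eq v (Y' w)
  simp only [flatLieOneForm, e2, h2.self_of_nhds, add_apply,
    ContinuousLinearMap.comp_apply, ContinuousLinearMap.flip_apply,
    ContinuousLinearMap.compL_apply, h1.self_of_nhds]
  rw [← e1v, hs, map_add]
  ring

/-! ### Extension by zero of fields defined in a chart. -/

section Extension

variable {n : ℕ} {M : Type u} [TopologicalSpace M]

/-- The support, carried to `M`, is compact, hence closed because `M` is Hausdorff, and it lies
inside the chart domain. Extensions by zero are therefore smooth also at boundary points of that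
domain. -/
theorem eventually_eq_zero_of_notMem_source [T2Space M] {G : Type*} [NormedAddCommGroup G]
    {e : OpenPartialHomeomorph M (Model n)} (ht : e.target = Set.univ) {v : Model n → G} (hv : HasCompactSupport v) {x : M}
    (hx : x ∉ e.source) : ∀ᶠ y in 𝓝 x, y ∈ e.source → v (e y) = 0 := by
  have hK : IsCompact (e.symm '' tsupport v) :=
    hv.isCompact.image_of_continuousOn (e.continuousOn_symm.mono (by simp [ht]))
  have hxK : x ∉ e.symm '' tsupport v := by
    rintro ⟨w, -, rfl⟩
    exact hx (e.map_target (by simp [ht]))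
  filter_upwards [hK.isClosed.isOpen_compl.mem_nhds hxK] with y hy hys
  by_contra h
  exact hy ⟨e y, subset_tsupport v h, e.left_inv hys⟩

variable [ChartedSpace (Model n) M] {e : OpenPartialHomeomorph M (Model n)}

open Classical in
/-- The vector field which is `v` in the chart `e`, and zero outside of its domain. -/
noncomputable def extendVField (e : OpenPartialHomeomorph M (Model n)) (v : Model n → Model n) :
    VField n M :=
  fun x => if x ∈ e.source then chartSymmDeriv e (e x) (v (e x)) else 0

open Classical in
/-- The 1-form which is `η` in the chart `e`, and zero outside of its domain. -/
noncomputable def extendOneForm (e : OpenPartialHomeomorph M (Model n))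
    (η : Model n → (Model n →L[ℝ] ℝ)) : OneForm n M :=
  fun x => if x ∈ e.source then (η (e x)).comp (chartDeriv e x) else 0

theorem extendVField_of_mem {x : M} (hx : x ∈ e.source) (v : Model n → Model n) :
    extendVField e v x = chartSymmDeriv e (e x) (v (e x)) :=
  if_pos hx

theorem extendOneForm_of_mem {x : M} (hx : x ∈ e.source) (η : Model n → (Model n →L[ℝ] ℝ)) :
    extendOneForm e η x = (η (e x)).comp (chartDeriv e x) :=
  if_pos hx

theorem chartVField_extendVField (he : e ∈ IsManifold.maximalAtlas (𝓡 n) ∞ M)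
    (v : Model n → Model n) {w : Model n} (hw : w ∈ e.target) :
    chartVField e (extendVField e v) w = v w := by
  rw [chartVField, extendVField_of_mem (e.map_target hw), e.right_inv hw]
  exact chartDeriv_chartSymmDeriv he hw _

theorem chartOneForm_extendOneForm (he : e ∈ IsManifold.maximalAtlas (𝓡 n) ∞ M)
    (η : Model n → (Model n →L[ℝ] ℝ)) {w : Model n} (hw : w ∈ e.target) :
    chartOneForm e (extendOneForm e η) w = η w := by
  rw [chartOneForm, extendOneForm_of_mem (e.map_target hw), e.right_inv hw]
  exact (ContinuousLinearMap.comp_assoc _ _ _).trans (by rw [chartDeriv_comp he hw]; rfl)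

end Extension

/-! ### Lie derivatives in an arbitrary chart, and smoothness of Lie derivatives and of extensions.
-/

section Charts

variable {n : ℕ} {M : Type u} [TopologicalSpace M] [ChartedSpace (Model n) M]
  [IsManifold (𝓡 n) ∞ M] {e : OpenPartialHomeomorph M (Model n)}

theorem chartVField_lieDerivVField (he : e ∈ IsManifold.maximalAtlas (𝓡 n) ∞ M)
    {Y X : VField n M} (hY : SmoothVFieldOn Y Set.univ) (hX : SmoothVFieldOn X Set.univ)
    {w : Model n} (hw : w ∈ e.target) :
    chartVField e (lieDerivVField Y X) w =
      VectorField.lieBracket ℝ (chartVField e Y) (chartVField e X) w := by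
  have hM : IsManifold (𝓡 n) (minSmoothness ℝ 2) M :=
    IsManifold.of_le (n := ∞) (by
      rw [minSmoothness_of_isRCLikeNormedField]; exact WithTop.coe_le_coe.2 le_top)
  have h := VectorField.mpullback_mlieBracket (I := 𝓡 n) (I' := 𝓡 n) (f := e.symm) (V := Y)
    (W := X) (x₀ := w) (n := ∞)
    (((hY.contMDiffAt univ_mem)).mdifferentiableAt (by simp))
    (((hX.contMDiffAt univ_mem)).mdifferentiableAt (by simp))
    (contMDiffAt_chart_symm he hw) (by
      rw [minSmoothness_of_isRCLikeNormedField]; exact WithTop.coe_le_coe.2 le_top)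
  rw [mpullback_chart_symm he hw] at h
  refine h.trans ?_
  rw [← VectorField.mlieBracketWithin_univ, VectorField.mlieBracketWithin_eq_lieBracketWithin]
  refine (congrFun VectorField.lieBracketWithin_univ w).trans ?_
  refine Filter.EventuallyEq.lieBracket_vectorField_eq ?_ ?_
  · filter_upwards [e.open_target.mem_nhds hw] with z hz using mpullback_chart_symm he hz Y
  · filter_upwards [e.open_target.mem_nhds hw] with z hz using mpullback_chart_symm he hz X

theorem contDiffAt_chartVField (he : e ∈ IsManifold.maximalAtlas (𝓡 n) ∞ M)
    {Y : VField n M} (hY : SmoothVFieldOn Y Set.univ) {w : Model n} (hw : w ∈ e.target) :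
    ContDiffAt ℝ ∞ (chartVField e Y) w := by
  have := (contMDiffAt_vField_iff he (e.map_target hw) Y).1 (hY.contMDiffAt univ_mem)
  rwa [e.right_inv hw] at this

theorem contDiffAt_chartOneForm (he : e ∈ IsManifold.maximalAtlas (𝓡 n) ∞ M)
    {ξ : OneForm n M} (hξ : SmoothOneFormOn ξ Set.univ) {w : Model n} (hw : w ∈ e.target) :
    ContDiffAt ℝ ∞ (chartOneForm e ξ) w := by
  have := (contMDiffAt_oneForm_iff he (e.map_target hw) ξ).1 (hξ.contMDiffAt univ_mem)
  rwa [e.right_inv hw] at this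

theorem lieDerivOneForm_eq (Y : VField n M) (ξ : OneForm n M) (x : M) :
    lieDerivOneForm Y ξ x = (flatLieOneForm (chartVField (chartAt (Model n) x) Y)
      (chartOneForm (chartAt (Model n) x) ξ) (chartAt (Model n) x x)).comp
        (chartDeriv (chartAt (Model n) x) x) := by
  have hc : chartAt (Model n) x ∈ IsManifold.maximalAtlas (𝓡 n) ∞ M :=
    IsManifold.chart_mem_maximalAtlas x
  have h : localVField Y x =ᶠ[𝓝 (chartAt (Model n) x x)] chartVField (chartAt (Model n) x) Y := by
    filter_upwards [(chartAt (Model n) x).open_target.mem_nhds (mem_chart_target _ x)] with z hz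
    exact mpullback_chart_symm hc hz Y
  have h2 := flatLieOneForm_congr (ξ := localOneForm ξ x) h Filter.EventuallyEq.rfl
  exact congrArg (fun L : Model n →L[ℝ] ℝ => L.comp (chartDeriv (chartAt (Model n) x) x)) h2

/-- The definition uses a different preferred chart at each point. Naturality under the transition
map `c ∘ e.symm` makes the coordinate formula valid in one fixed chart, which is what allows it to
be differentiated or compared with `E`. -/
theorem chartOneForm_lieDerivOneForm (he : e ∈ IsManifold.maximalAtlas (𝓡 n) ∞ M)
    {Y : VField n M} {ξ : OneForm n M} (hY : SmoothVFieldOn Y Set.univ)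
    (hξ : SmoothOneFormOn ξ Set.univ) {w : Model n} (hw : w ∈ e.target) :
    chartOneForm e (lieDerivOneForm Y ξ) w =
      flatLieOneForm (chartVField e Y) (chartOneForm e ξ) w := by
  set c := chartAt (Model n) (e.symm w) with hcdef
  have hc : c ∈ IsManifold.maximalAtlas (𝓡 n) ∞ M := IsManifold.chart_mem_maximalAtlas _
  have hx : e.symm w ∈ c.source := mem_chart_source _ _
  have hev : ∀ᶠ z in 𝓝 w, z ∈ e.target ∧ e.symm z ∈ c.source :=
    Filter.Eventually.and (e.open_target.mem_nhds hw)
      ((e.continuousAt_symm hw).preimage_mem_nhds (c.open_source.mem_nhds hx))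
  have hd : ∀ z, z ∈ e.target ∧ e.symm z ∈ c.source →
      fderiv ℝ (c ∘ e.symm) z = (chartDeriv c (e.symm z)).comp (chartSymmDeriv e z) := by
    rintro z ⟨hz, hz'⟩
    rw [← mfderiv_eq_fderiv]
    exact mfderiv_comp z ((contMDiffAt_chart hc hz').mdifferentiableAt (by simp))
      ((contMDiffAt_chart_symm he hz).mdifferentiableAt (by simp))
  have key := flatLieOneForm_of_related (φ := c ∘ e.symm) (Y := chartVField c Y)
    (Y' := chartVField e Y) (ξ := chartOneForm c ξ) (ξ' := chartOneForm e ξ) (w := w)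
    ((contMDiffAt_chart hc hx).comp w (contMDiffAt_chart_symm he hw)).contDiffAt
    ((contDiffAt_chartVField hc hY (c.map_source hx)).differentiableAt (by simp))
    ((contDiffAt_chartVField he hY hw).differentiableAt (by simp))
    ((contDiffAt_chartOneForm hc hξ (c.map_source hx)).differentiableAt (by simp))
    (hev.mono fun z hz => by
      rw [hd z hz, ContinuousLinearMap.comp_apply, chartSymmDeriv_chartVField he hz.1]
      exact (chartVField_apply hz.2 Y).symm)
    (hev.mono fun z hz => by
      have h := chartOneForm_comp hc (c.map_source hz.2) ξ
      rw [c.left_inv hz.2] at h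
      rw [hd z hz, ← ContinuousLinearMap.comp_assoc, Function.comp_apply, h]
      rfl)
  rw [key, hd w ⟨hw, hx⟩, chartOneForm, lieDerivOneForm_eq]
  rfl

theorem smoothVFieldOn_lieDerivVField {Y X : VField n M} (hY : SmoothVFieldOn Y Set.univ)
    (hX : SmoothVFieldOn X Set.univ) : SmoothVFieldOn (lieDerivVField Y X) Set.univ := by
  intro x _
  have hc : chartAt (Model n) x ∈ IsManifold.maximalAtlas (𝓡 n) ∞ M :=
    IsManifold.chart_mem_maximalAtlas _
  have hw := mem_chart_target (Model n) x
  refine ((contMDiffAt_vField_iff hc (mem_chart_source _ x) _).2 ?_).contMDiffWithinAt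
  have h1 := contDiffAt_chartVField hc hY hw
  have h2 := contDiffAt_chartVField hc hX hw
  refine ContDiffAt.congr_of_eventuallyEq (f := fun w => VectorField.lieBracket ℝ
    (chartVField (chartAt (Model n) x) Y) (chartVField (chartAt (Model n) x) X) w) ?_ ?_
  · simp only [VectorField.lieBracket]
    exact ((h2.fderiv_right (m := ∞) (by simp)).clm_apply h1).sub
      ((h1.fderiv_right (m := ∞) (by simp)).clm_apply h2)
  · filter_upwards [(chartAt (Model n) x).open_target.mem_nhds hw] with z hz
    exact chartVField_lieDerivVField hc hY hX hz

theorem smoothOneFormOn_lieDerivOneForm {Y : VField n M} {ξ : OneForm n M}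
    (hY : SmoothVFieldOn Y Set.univ) (hξ : SmoothOneFormOn ξ Set.univ) :
    SmoothOneFormOn (lieDerivOneForm Y ξ) Set.univ := by
  intro x _
  have hc : chartAt (Model n) x ∈ IsManifold.maximalAtlas (𝓡 n) ∞ M :=
    IsManifold.chart_mem_maximalAtlas _
  have hw := mem_chart_target (Model n) x
  refine ((contMDiffAt_oneForm_iff hc (mem_chart_source _ x) _).2 ?_).contMDiffWithinAt
  have h1 := contDiffAt_chartVField hc hY hw
  have h2 := contDiffAt_chartOneForm hc hξ hw
  refine ContDiffAt.congr_of_eventuallyEq (f := fun w => flatLieOneForm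
    (chartVField (chartAt (Model n) x) Y) (chartOneForm (chartAt (Model n) x) ξ) w) ?_ ?_
  · simp only [flatLieOneForm]
    exact ((h2.fderiv_right (m := ∞) (by simp)).clm_apply h1).add
      (h2.clm_comp (h1.fderiv_right (m := ∞) (by simp)))
  · filter_upwards [(chartAt (Model n) x).open_target.mem_nhds hw] with z hz
    exact chartOneForm_lieDerivOneForm hc hY hξ hz

theorem smoothVFieldOn_extendVField [T2Space M] (he : e ∈ IsManifold.maximalAtlas (𝓡 n) ∞ M)
    (ht : e.target = Set.univ) {v : Model n → Model n} (hv : ContDiff ℝ ∞ v)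
    (hc : HasCompactSupport v) : SmoothVFieldOn (extendVField e v) Set.univ := by
  intro x _
  refine ContMDiffAt.contMDiffWithinAt ?_
  by_cases hx : x ∈ e.source
  · refine (contMDiffAt_vField_iff he hx _).2 ?_
    have : chartVField e (extendVField e v) = v :=
      funext fun w => chartVField_extendVField he v (by simp [ht])
    rw [this]
    exact hv.contDiffAt
  · have h0 : ContMDiffAt (𝓡 n) (𝓡 n).tangent ∞
        (fun x => (⟨x, (0 : VField n M) x⟩ : TangentBundle (𝓡 n) M)) x := by
      refine (contMDiffAt_vField_iff (IsManifold.chart_mem_maximalAtlas x)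
        (mem_chart_source _ x) _).2 ?_
      have : chartVField (chartAt (Model n) x) (0 : VField n M) = fun _ => 0 :=
        funext fun w => map_zero (chartDeriv _ _)
      rw [this]
      exact contDiffAt_const
    refine h0.congr_of_eventuallyEq ?_
    filter_upwards [eventually_eq_zero_of_notMem_source ht hc hx] with y hy
    refine congrArg (Bundle.TotalSpace.mk y) ?_
    by_cases hys : y ∈ e.source
    · rw [extendVField_of_mem hys, hy hys]
      exact map_zero _
    · exact if_neg hys

theorem smoothOneFormOn_extendOneForm [T2Space M] (he : e ∈ IsManifold.maximalAtlas (𝓡 n) ∞ M)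
    (ht : e.target = Set.univ) {η : Model n → (Model n →L[ℝ] ℝ)} (hη : ContDiff ℝ ∞ η)
    (hc : HasCompactSupport η) : SmoothOneFormOn (extendOneForm e η) Set.univ := by
  intro x _
  refine ContMDiffAt.contMDiffWithinAt ?_
  by_cases hx : x ∈ e.source
  · refine (contMDiffAt_oneForm_iff he hx _).2 ?_
    have : chartOneForm e (extendOneForm e η) = η :=
      funext fun w => chartOneForm_extendOneForm he η (by simp [ht])
    rw [this]
    exact hη.contDiffAt
  · have h0 : ContMDiffAt (𝓡 n) ((𝓡 n).prod 𝓘(ℝ, Model n →L[ℝ] ℝ)) ∞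
        (fun x => Bundle.TotalSpace.mk' (Model n →L[ℝ] ℝ)
          (E := fun y : M => TangentSpace (𝓡 n) y →L[ℝ] Bundle.Trivial M ℝ y) x
            ((0 : OneForm n M) x)) x := by
      refine (contMDiffAt_oneForm_iff (IsManifold.chart_mem_maximalAtlas x)
        (mem_chart_source _ x) _).2 ?_
      have : chartOneForm (chartAt (Model n) x) (0 : OneForm n M) = fun _ => 0 :=
        funext fun w => ContinuousLinearMap.zero_comp _
      rw [this]
      exact contDiffAt_const
    refine h0.congr_of_eventuallyEq ?_
    filter_upwards [eventually_eq_zero_of_notMem_source ht hc hx] with y hy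
    refine congrArg (Bundle.TotalSpace.mk' (Model n →L[ℝ] ℝ)
      (E := fun y : M => TangentSpace (𝓡 n) y →L[ℝ] Bundle.Trivial M ℝ y) y) ?_
    by_cases hys : y ∈ e.source
    · rw [extendOneForm_of_mem hys, hy hys]
      exact ContinuousLinearMap.zero_comp _
    · exact if_neg hys

end Charts

/-! ### The transverse projection of `ℝ^(p+q)` onto `ℝ^q` and its linear section. -/

section Transverse

variable (p q : ℕ)

/-- The projection of `ℝ^(p+q)` onto the last `q` coordinates. -/
noncomputable def transProj : Model (p + q) →L[ℝ] Model q :=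
  LinearMap.toContinuousLinearMap
    { toFun := fun w => WithLp.toLp 2 fun j => w (Fin.natAdd p j)
      map_add' := fun _ _ => rfl
      map_smul' := fun _ _ => rfl }

/-- The inclusion of `ℝ^q` in `ℝ^(p+q)` as the last `q` coordinates. -/
noncomputable def transIncl : Model q →L[ℝ] Model (p + q) :=
  LinearMap.toContinuousLinearMap
    { toFun := fun y => WithLp.toLp 2 (Fin.append (0 : Fin p → ℝ) y)
      map_add' := fun x y => by
        ext i
        refine Fin.addCases (fun i => ?_) (fun i => ?_) i <;> simp
      map_smul' := fun c y => by
        ext i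
        refine Fin.addCases (fun i => ?_) (fun i => ?_) i <;> simp }

variable {p q}

@[simp]
theorem transProj_apply (w : Model (p + q)) (j : Fin q) :
    transProj p q w j = w (Fin.natAdd p j) :=
  rfl

@[simp]
theorem transProj_transIncl (y : Model q) : transProj p q (transIncl p q y) = y := by
  ext j
  change Fin.append (0 : Fin p → ℝ) y (Fin.natAdd p j) = y j
  simp

theorem transProj_comp_transIncl :
    (transProj p q).comp (transIncl p q) = ContinuousLinearMap.id ℝ (Model q) :=
  ContinuousLinearMap.ext transProj_transIncl

theorem transProj_eq_zero_iff (w : Model (p + q)) :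
    transProj p q w = 0 ↔ ∀ j : Fin q, w (Fin.natAdd p j) = 0 := by
  constructor
  · intro h j
    simpa using congrArg (fun y : Model q => y j) h
  · intro h
    ext j
    simpa using h j

end Transverse

/-! ### Diffeomorphisms from open cubes onto the whole space, acting coordinate by coordinate. -/

section CubeChart

variable {m : ℕ}

/-- The open cube with centre `c` and half-side `r`, as an open set diffeomorphic to `ℝ^m` by a
diffeomorphism that acts on each coordinate separately. -/
noncomputable def cubeChart (c : Model m) {r : ℝ} (hr : 0 < r) :
    OpenPartialHomeomorph (Model m) (Model m) where
  toFun z := WithLp.toLp 2 fun i => (OpenPartialHomeomorph.univBall (c i) r).symm (z i)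
  invFun z := WithLp.toLp 2 fun i => OpenPartialHomeomorph.univBall (c i) r (z i)
  source := {z | ∀ i, z i ∈ Metric.ball (c i) r}
  target := Set.univ
  map_source' _ _ := trivial
  map_target' z _ i := by
    rw [← OpenPartialHomeomorph.univBall_target (c i) hr]
    exact (OpenPartialHomeomorph.univBall (c i) r).map_source (by simp)
  left_inv' z hz := by
    ext i
    exact (OpenPartialHomeomorph.univBall (c i) r).right_inv
      (by rw [OpenPartialHomeomorph.univBall_target (c i) hr]; exact hz i)
  right_inv' z _ := by
    ext i
    exact (OpenPartialHomeomorph.univBall (c i) r).left_inv (by simp)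
  open_source := by
    simp only [Set.ofPred_forall]
    exact isOpen_iInter_of_finite fun i =>
      Metric.isOpen_ball.preimage (EuclideanSpace.proj (𝕜 := ℝ) i).continuous
  open_target := isOpen_univ
  continuousOn_toFun := by
    refine (contDiffOn_euclidean (n := 0).2 fun i => ?_).continuousOn
    exact (OpenPartialHomeomorph.contDiffOn_univBall_symm (n := 0)).comp
      (EuclideanSpace.proj (𝕜 := ℝ) i).contDiff.contDiffOn fun z hz => hz i
  continuousOn_invFun := by
    refine (contDiff_euclidean (n := 0).2 fun i => ?_).continuous.continuousOn
    exact (OpenPartialHomeomorph.contDiff_univBall (n := 0)).comp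
      (EuclideanSpace.proj (𝕜 := ℝ) i).contDiff

theorem contDiffOn_cubeChart (c : Model m) {r : ℝ} (hr : 0 < r) :
    ContDiffOn ℝ ∞ (cubeChart c hr) (cubeChart c hr).source :=
  contDiffOn_euclidean.2 fun i => OpenPartialHomeomorph.contDiffOn_univBall_symm.comp
    (EuclideanSpace.proj (𝕜 := ℝ) i).contDiff.contDiffOn fun _ hz => hz i

theorem contDiff_cubeChart_symm (c : Model m) {r : ℝ} (hr : 0 < r) :
    ContDiff ℝ ∞ (cubeChart c hr).symm :=
  contDiff_euclidean.2 fun i => OpenPartialHomeomorph.contDiff_univBall.comp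
    (EuclideanSpace.proj (𝕜 := ℝ) i).contDiff

theorem cubeChart_mem_contDiffGroupoid (c : Model m) {r : ℝ} (hr : 0 < r) :
    cubeChart c hr ∈ contDiffGroupoid ∞ (𝓡 m) := by
  rw [contDiffGroupoid, mem_groupoid_of_pregroupoid]
  refine ⟨?_, ?_⟩
  · simpa [contDiffPregroupoid] using contDiffOn_cubeChart c hr
  · simpa [contDiffPregroupoid] using
      (contDiff_cubeChart_symm c hr).contDiffOn

/-- The differential of `cubeChart` is diagonal and invertible. -/
theorem fderiv_cubeChart_apply_eq_zero_iff (c : Model m) {r : ℝ} (hr : 0 < r) {z : Model m}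
    (hz : z ∈ (cubeChart c hr).source) (v : Model m) (i : Fin m) :
    fderiv ℝ (cubeChart c hr) z v i = 0 ↔ v i = 0 := by
  set ρ := OpenPartialHomeomorph.univBall (c i) r
  have hzi : z i ∈ ρ.target := by
    rw [OpenPartialHomeomorph.univBall_target (c i) hr]
    exact hz i
  have h1 : HasDerivAt ρ.symm (deriv ρ.symm (z i)) (z i) := by
    refine (((OpenPartialHomeomorph.contDiffOn_univBall_symm (n := 1) (c := c i)
      (r := r)).contDiffAt ?_).differentiableAt (by simp)).hasDerivAt
    exact Metric.isOpen_ball.mem_nhds (hz i)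
  have h2 : HasDerivAt ρ (deriv ρ (ρ.symm (z i))) (ρ.symm (z i)) :=
    ((OpenPartialHomeomorph.contDiff_univBall (n := 1)).differentiable (by simp) _).hasDerivAt
  -- The chain rule applied to `ρ ∘ ρ.symm = id` shows that the diagonal entry is nonzero.
  have h3 : deriv ρ (ρ.symm (z i)) * deriv ρ.symm (z i) = 1 := by
    refine ((h2.comp (z i) h1).congr_of_eventuallyEq ?_).unique (hasDerivAt_id (z i))
    filter_upwards [ρ.open_target.mem_nhds hzi] with t ht
    exact (ρ.right_inv ht).symm
  have h4 : fderiv ℝ (cubeChart c hr) z v i = deriv ρ.symm (z i) * v i := by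
    have hd : HasFDerivAt (cubeChart c hr) (fderiv ℝ (cubeChart c hr) z) z :=
      (((contDiffOn_cubeChart c hr).contDiffAt
        ((cubeChart c hr).open_source.mem_nhds hz)).differentiableAt (by simp)).hasFDerivAt
    have hl := (EuclideanSpace.proj (𝕜 := ℝ) i).hasFDerivAt.comp z hd
    have hr := h1.comp_hasFDerivAt z (EuclideanSpace.proj (𝕜 := ℝ) i).hasFDerivAt
    have := congrArg (fun L : Model m →L[ℝ] ℝ => L v) (hl.unique hr)
    simpa using this
  rw [h4]
  have : deriv ρ.symm (z i) ≠ 0 := right_ne_zero_of_mul_eq_one h3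
  simp [this]

theorem exists_cubeChart_source_subset {c : Model m} {s : Set (Model m)} (hs : s ∈ 𝓝 c) :
    ∃ (r : ℝ) (hr : 0 < r), (cubeChart c hr).source ⊆ s := by
  have hs' : (WithLp.toLp 2 : (Fin m → ℝ) → Model m) ⁻¹' s ∈ 𝓝 (c.ofLp) :=
    (PiLp.continuous_toLp 2 _).continuousAt.preimage_mem_nhds hs
  obtain ⟨r, hr, h⟩ := Metric.mem_nhds_iff.1 hs'
  refine ⟨r, hr, fun z hz => ?_⟩
  exact h (a := z.ofLp) (by
    rw [Metric.mem_ball, dist_pi_lt_iff hr]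
    exact hz)

theorem trans_mem_maximalAtlas {H M : Type*} [TopologicalSpace H] [TopologicalSpace M]
    [ChartedSpace H M] {G : StructureGroupoid H} {e : OpenPartialHomeomorph M H}
    (he : e ∈ StructureGroupoid.maximalAtlas M G) {g : OpenPartialHomeomorph H H} (hg : g ∈ G) :
    e.trans g ∈ StructureGroupoid.maximalAtlas M G := by
  rw [mem_maximalAtlas_iff] at he ⊢
  intro e' he'
  obtain ⟨h1, h2⟩ := he e' he'
  constructor
  · rw [OpenPartialHomeomorph.trans_symm_eq_symm_trans_symm, OpenPartialHomeomorph.trans_assoc]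
    exact G.trans (G.symm hg) h1
  · rw [← OpenPartialHomeomorph.trans_assoc]
    exact G.trans h2 hg

end CubeChart

/-! ### Foliated charts onto the whole model space. -/

section FoliatedChart

variable {p q : ℕ} {M : Type u} [TopologicalSpace M] [ChartedSpace (Model (p + q)) M]

/-- A chart onto the whole of `ℝ^(p+q)` in which the leaves are the fibres of the projection onto
the last `q` coordinates. -/
structure IsFoliatedChart (F : Foliation p q M) (e : OpenPartialHomeomorph M (Model (p + q))) :
    Prop where
  mem : e ∈ IsManifold.maximalAtlas (𝓡 (p + q)) ∞ M
  target_eq : e.target = Set.univ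
  mem_tangent_iff : ∀ x ∈ e.source, ∀ v : Model (p + q),
    v ∈ F.tangent x ↔ transProj p q (chartDeriv e x v) = 0

/-- A chart of the foliation is shrunk to a small cube, which is then stretched onto the whole
space. A cube is used rather than a ball because the stretching must have a diagonal differential,
so that it preserves the equations `dy¹ = ⋯ = dy^q = 0`. -/
theorem exists_isFoliatedChart (F : Foliation p q M) (x₀ : M) {W : Set M} (hW : W ∈ 𝓝 x₀) :
    ∃ e, IsFoliatedChart F e ∧ x₀ ∈ e.source ∧ e.source ⊆ W := by
  obtain ⟨e, he, hx₀, hF⟩ := F.exists_chart x₀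
  have hW' : e.target ∩ e.symm ⁻¹' W ∈ 𝓝 (e x₀) := by
    refine Filter.inter_mem (e.open_target.mem_nhds (e.map_source hx₀)) ?_
    refine (e.continuousAt_symm (e.map_source hx₀)).preimage_mem_nhds ?_
    rwa [e.left_inv hx₀]
  obtain ⟨r, hr, hsub⟩ := exists_cubeChart_source_subset hW'
  refine ⟨e.trans (cubeChart (e x₀) hr), ⟨?_, ?_, ?_⟩, ?_, ?_⟩
  · exact trans_mem_maximalAtlas he (cubeChart_mem_contDiffGroupoid _ hr)
  · rw [OpenPartialHomeomorph.trans_target]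
    refine Set.eq_univ_of_forall fun w => ⟨trivial, ?_⟩
    exact (hsub ((cubeChart (e x₀) hr).map_target (x := w) trivial)).1
  · intro x hx v
    rw [OpenPartialHomeomorph.trans_source] at hx
    have hd : chartDeriv (e.trans (cubeChart (e x₀) hr)) x =
        (fderiv ℝ (cubeChart (e x₀) hr) (e x)).comp (chartDeriv e x) := by
      rw [← mfderiv_eq_fderiv]
      exact mfderiv_comp x
        (((contDiffOn_cubeChart (e x₀) hr).contDiffAt ((cubeChart (e x₀) hr).open_source.mem_nhds
          hx.2)).contMDiffAt.mdifferentiableAt (by simp))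
        ((contMDiffAt_chart he hx.1).mdifferentiableAt (by simp))
    rw [hd, transProj_eq_zero_iff]
    refine (hF x hx.1 v).trans (forall_congr' fun j =>
      (fderiv_cubeChart_apply_eq_zero_iff (e x₀) hr hx.2 _ _).symm)
  · rw [OpenPartialHomeomorph.trans_source]
    exact ⟨hx₀, fun i => Metric.mem_ball_self hr⟩
  · intro x hx
    rw [OpenPartialHomeomorph.trans_source] at hx
    have := (hsub hx.2).2
    rwa [Set.mem_preimage, e.left_inv hx.1] at this

variable {F : Foliation p q M} {e : OpenPartialHomeomorph M (Model (p + q))}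

namespace IsFoliatedChart

theorem mem_target (he : IsFoliatedChart F e) (w : Model (p + q)) : w ∈ e.target := by
  rw [he.target_eq]
  trivial

theorem map_target (he : IsFoliatedChart F e) (w : Model (p + q)) : e.symm w ∈ e.source :=
  e.map_target (he.mem_target w)

theorem right_inv (he : IsFoliatedChart F e) (w : Model (p + q)) : e (e.symm w) = w :=
  e.right_inv (he.mem_target w)

theorem chartSymmDeriv_mem_tangent_iff (he : IsFoliatedChart F e) (w v : Model (p + q)) :
    chartSymmDeriv e w v ∈ F.tangent (e.symm w) ↔ transProj p q v = 0 := by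
  have h := he.mem_tangent_iff _ (he.map_target w) (chartSymmDeriv e w v)
  rwa [chartDeriv_chartSymmDeriv he.mem (he.mem_target w)] at h

/-- The curve is the straight segment of the chart, which stays in the domain since the target is
everything. -/
theorem leafCurve (he : IsFoliatedChart F e) {U : Set M} (hU : e.source ⊆ U) (w v : Model (p + q))
    (hv : transProj p q v = 0) : LeafCurve F U (e.symm w) (e.symm (w + v)) := by
  have hline : ∀ t : ℝ, HasDerivAt (fun t : ℝ => w + t • v) v t := fun t => by
    simpa using ((hasDerivAt_id t).smul_const v).const_add w
  refine ⟨fun t => e.symm (w + t • v), by simp, by simp, fun t _ => ⟨?_, ?_, ?_⟩⟩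
  · refine (contMDiffAt_chart_symm he.mem (he.mem_target _)).comp t ?_
    exact ContDiffAt.contMDiffAt (by fun_prop)
  · exact hU (he.map_target _)
  · have h := mfderiv_comp t (I := 𝓘(ℝ, ℝ)) (I' := 𝓡 (p + q)) (I'' := 𝓡 (p + q)) (g := e.symm)
      (f := fun t : ℝ => w + t • v)
      ((contMDiffAt_chart_symm he.mem (he.mem_target _)).mdifferentiableAt (by simp))
      (hline t).differentiableAt.mdifferentiableAt
    have h1 : mfderiv 𝓘(ℝ, ℝ) (𝓡 (p + q)) (fun t => e.symm (w + t • v)) t (1 : ℝ) =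
        chartSymmDeriv e (w + t • v) v := by
      refine (congrArg (fun L : ℝ →L[ℝ] Model (p + q) => L 1) h).trans ?_
      refine congrArg (chartSymmDeriv e (w + t • v)) ?_
      refine (congrArg (fun L : ℝ →L[ℝ] Model (p + q) => L 1) mfderiv_eq_fderiv).trans ?_
      rw [fderiv_apply_one_eq_deriv]
      exact (hline t).deriv
    rw [h1]
    exact (he.chartSymmDeriv_mem_tangent_iff _ _).2 hv

/-- Along a curve tangent to the foliation the transverse coordinates have zero derivative. -/
theorem transProj_eq_of_leafCurve (he : IsFoliatedChart F e) {x y : M}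
    (h : LeafCurve F e.source x y) : transProj p q (e x) = transProj p q (e y) := by
  obtain ⟨γ, rfl, rfl, hγ⟩ := h
  have hd : ∀ t ∈ Set.Icc (0 : ℝ) 1, HasDerivAt (fun t => transProj p q (e (γ t))) 0 t := by
    intro t ht
    obtain ⟨h1, h2, h3⟩ := hγ t ht
    have hm := (contMDiffAt_chart he.mem h2).comp t h1
    have hdiff : DifferentiableAt ℝ (e ∘ γ) t := hm.contDiffAt.differentiableAt (by simp)
    have hd : fderiv ℝ (e ∘ γ) t 1 =
        chartDeriv e (γ t) (mfderiv 𝓘(ℝ, ℝ) (𝓡 (p + q)) γ t (1 : ℝ)) := by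
      rw [← mfderiv_eq_fderiv]
      exact congrArg (fun L : ℝ →L[ℝ] Model (p + q) => L 1)
        (mfderiv_comp t ((contMDiffAt_chart he.mem h2).mdifferentiableAt (by simp))
          (h1.mdifferentiableAt (by simp)))
    have := ((transProj p q).hasFDerivAt.comp t hdiff.hasFDerivAt).hasDerivAt
    rw [ContinuousLinearMap.comp_apply, hd, (he.mem_tangent_iff _ h2 _).1 h3] at this
    exact this
  exact (constant_of_has_deriv_right_zero (fun t ht => (hd t ht).continuousAt.continuousWithinAt)
    (fun t ht => (hd t ⟨ht.1, ht.2.le⟩).hasDerivWithinAt) 1 (by simp)).symm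

theorem sameLeaf_iff (he : IsFoliatedChart F e) {x y : M} (hx : x ∈ e.source)
    (hy : y ∈ e.source) :
    SameLeaf F e.source x y ↔ transProj p q (e x) = transProj p q (e y) := by
  constructor
  · intro h
    -- The induction on the generated equivalence relation passes through arbitrary intermediate
    -- points, so the endpoints must be left free.
    clear hx hy
    induction h with
    | rel x y h => exact he.transProj_eq_of_leafCurve h
    | refl x => rfl
    | symm x y _ ih => exact ih.symm
    | trans x y z _ _ ih1 ih2 => exact ih1.trans ih2
  · intro h
    have := he.leafCurve subset_rfl (e x) (e y - e x) (by rw [map_sub, h, sub_self])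
    rw [add_sub_cancel, e.left_inv hx, e.left_inv hy] at this
    exact Relation.EqvGen.rel _ _ this

end IsFoliatedChart

end FoliatedChart

/-! ### The leaf space of a foliated chart: `ℝ^q`, lifted to the universe of `M`. -/

section LeafModel

/-- The space `ℝ^q`, in an arbitrary universe. -/
def LeafModel (q : ℕ) : Type u := ULift.{u} (Model q)

variable (q : ℕ)

instance : TopologicalSpace (LeafModel.{u} q) :=
  inferInstanceAs (TopologicalSpace (ULift.{u} (Model q)))

instance : T2Space (LeafModel.{u} q) :=
  inferInstanceAs (T2Space (ULift.{u} (Model q)))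

/-- The global chart of `LeafModel q`. -/
def leafModelChart : OpenPartialHomeomorph (LeafModel.{u} q) (Model q) :=
  Homeomorph.ulift.{u}.toOpenPartialHomeomorph

instance : ChartedSpace (Model q) (LeafModel.{u} q) :=
  (leafModelChart q).singletonChartedSpace rfl

instance : IsManifold (𝓡 q) ∞ (LeafModel.{u} q) :=
  (leafModelChart q).isManifold_singleton rfl

theorem leafModelChart_mem :
    leafModelChart.{u} q ∈ IsManifold.maximalAtlas (𝓡 q) ∞ (LeafModel.{u} q) :=
  IsManifold.subset_maximalAtlas (Set.mem_singleton _)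

@[simp]
theorem chartDeriv_leafModelChart (y : LeafModel.{u} q) :
    chartDeriv (leafModelChart q) y = ContinuousLinearMap.id ℝ (Model q) := by
  have h := (contMDiffAt_chart (leafModelChart_mem.{u} q) (x := y) trivial).mdifferentiableAt
    (by simp)
  refine h.mfderiv.trans ?_
  have : writtenInExtChartAt (𝓡 q) (𝓡 q) y (leafModelChart.{u} q) = id := rfl
  rw [this]
  refine (fderivWithin_id ?_)
  simp [uniqueDiffWithinAt_univ]

@[simp]
theorem chartSymmDeriv_leafModelChart (w : Model q) :
    chartSymmDeriv (leafModelChart.{u} q) w = ContinuousLinearMap.id ℝ (Model q) := by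
  have := chartDeriv_comp (leafModelChart_mem.{u} q) (w := w) trivial
  rwa [chartDeriv_leafModelChart] at this

variable {q}
variable {p : ℕ} {M : Type u} [TopologicalSpace M] [ChartedSpace (Model (p + q)) M]

/-- The projection of a foliated chart onto its leaf space. -/
noncomputable def leafProj (e : OpenPartialHomeomorph M (Model (p + q))) (x : M) :
    LeafModel.{u} q :=
  (leafModelChart q).symm (transProj p q (e x))

variable {F : Foliation p q M} {e : OpenPartialHomeomorph M (Model (p + q))}

theorem IsFoliatedChart.contMDiffAt_leafProj (he : IsFoliatedChart F e) {x : M}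
    (hx : x ∈ e.source) : ContMDiffAt (𝓡 (p + q)) (𝓡 q) ∞ (leafProj e) x :=
  (contMDiffAt_chart_symm (leafModelChart_mem q) trivial).comp x
    ((transProj p q).contDiff.contMDiff.contMDiffAt.comp x (contMDiffAt_chart he.mem hx))

theorem IsFoliatedChart.mfderiv_leafProj (he : IsFoliatedChart F e) {x : M}
    (hx : x ∈ e.source) (v : Model (p + q)) :
    mfderiv (𝓡 (p + q)) (𝓡 q) (leafProj e) x v = transProj p q (chartDeriv e x v) := by
  have h1 := mfderiv_comp x (I := 𝓡 (p + q)) (I' := 𝓡 (p + q)) (I'' := 𝓡 q) (g := transProj p q)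
    (f := e) (((transProj p q).contDiff (n := 1)).contMDiff.contMDiffAt.mdifferentiableAt (by simp))
    ((contMDiffAt_chart he.mem hx).mdifferentiableAt (by simp))
  have h2 := mfderiv_comp x (I := 𝓡 (p + q)) (I' := 𝓡 q) (I'' := 𝓡 q)
    (g := (leafModelChart.{u} q).symm) (f := transProj p q ∘ e)
    ((contMDiffAt_chart_symm (leafModelChart_mem q) trivial).mdifferentiableAt (by simp))
    (((transProj p q).contDiff.contMDiff.contMDiffAt.comp x
      (contMDiffAt_chart he.mem hx)).mdifferentiableAt (by simp))
  refine (congrArg (fun L : Model (p + q) →L[ℝ] Model q => L v) h2).trans ?_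
  change chartSymmDeriv (leafModelChart.{u} q) _ _ = _
  rw [chartSymmDeriv_leafModelChart]
  refine (congrArg (fun L : Model (p + q) →L[ℝ] Model q => L v) h1).trans ?_
  refine (congrArg (fun L : Model (p + q) →L[ℝ] Model q => L (chartDeriv e x v))
    mfderiv_eq_fderiv).trans ?_
  rw [ContinuousLinearMap.fderiv]

theorem IsFoliatedChart.isLeafSpace (he : IsFoliatedChart F e) :
    IsLeafSpace F e.source (leafProj e) where
  isOpen := e.open_source
  smooth x hx := (he.contMDiffAt_leafProj hx).contMDiffWithinAt
  surjOn y _ := ⟨e.symm (transIncl p q (leafModelChart q y)), he.map_target _, by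
    rw [leafProj, he.right_inv, transProj_transIncl]
    rfl⟩
  submersion x hx y := by
    refine ⟨chartSymmDeriv e (e x) (transIncl p q y), ?_⟩
    refine (he.mfderiv_leafProj hx _).trans ?_
    have := chartDeriv_chartSymmDeriv he.mem (he.mem_target (e x)) (transIncl p q y)
    rw [e.left_inv hx] at this
    rw [this]
    exact transProj_transIncl y
  ker_eq x hx v := by
    refine Iff.trans ?_ (he.mem_tangent_iff x hx v).symm
    exact (he.mfderiv_leafProj hx v).congr_left
  fiber_eq x hx y hy := by
    rw [he.sameLeaf_iff hx hy]
    exact (leafModelChart.{u} q).symm.injOn.eq_iff trivial trivial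

end LeafModel

/-! ### Subbundles and their frames read in a chart. -/

section ChartFiber

variable {n : ℕ} {M : Type u} [TopologicalSpace M] [ChartedSpace (Model n) M]
  {e : OpenPartialHomeomorph M (Model n)}

/-- The map from `ℝⁿ × (ℝⁿ)*` to `TₓM × T*ₓM`, `x = e⁻¹ w`, given by a chart `e`. -/
noncomputable def bigChartMap (e : OpenPartialHomeomorph M (Model n)) (w : Model n) :
    (Model n × (Model n →L[ℝ] ℝ)) →ₗ[ℝ] TBig n (e.symm w) where
  toFun b := (chartSymmDeriv e w b.1, b.2.comp (chartDeriv e (e.symm w)))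
  map_add' _ _ := Prod.ext (map_add _ _ _) (ContinuousLinearMap.add_comp _ _ _)
  map_smul' _ _ := Prod.ext (map_smul _ _ _) (ContinuousLinearMap.smul_comp _ _ _)

/-- The map `bigChartMap` as a linear equivalence. -/
noncomputable def bigChartEquiv (he : e ∈ IsManifold.maximalAtlas (𝓡 n) ∞ M) {w : Model n}
    (hw : w ∈ e.target) : (Model n × (Model n →L[ℝ] ℝ)) ≃ₗ[ℝ] TBig n (e.symm w) where
  __ := bigChartMap e w
  invFun b := (chartDeriv e (e.symm w) b.1,
    (show Model n →L[ℝ] ℝ from b.2).comp (chartSymmDeriv e w))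
  left_inv b := Prod.ext (chartDeriv_chartSymmDeriv he hw b.1)
    ((ContinuousLinearMap.comp_assoc _ _ _).trans (by rw [chartDeriv_comp he hw]; rfl))
  right_inv b := by
    have h := chartSymmDeriv_comp he (e.map_target hw)
    rw [e.right_inv hw] at h
    exact Prod.ext (congrArg (fun L : Model n →L[ℝ] Model n => L b.1) h)
      (congrArg (fun L : Model n →L[ℝ] Model n => (show Model n →L[ℝ] ℝ from b.2).comp L) h)

/-- The fibre of a field of subspaces of the big tangent bundle, read in a chart. -/
noncomputable def chartFiber (E : (x : M) → Submodule ℝ (TBig n x))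
    (e : OpenPartialHomeomorph M (Model n)) (w : Model n) :
    Submodule ℝ (Model n × (Model n →L[ℝ] ℝ)) :=
  (E (e.symm w)).comap (bigChartMap e w)

theorem mem_chartFiber {E : (x : M) → Submodule ℝ (TBig n x)} {w : Model n}
    {b : Model n × (Model n →L[ℝ] ℝ)} :
    b ∈ chartFiber E e w ↔ ((chartSymmDeriv e w b.1, b.2.comp (chartDeriv e (e.symm w))) :
      TBig n (e.symm w)) ∈ E (e.symm w) :=
  Iff.rfl

theorem chartFiber_eq_comap (he : e ∈ IsManifold.maximalAtlas (𝓡 n) ∞ M) {w : Model n}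
    (hw : w ∈ e.target) (E : (x : M) → Submodule ℝ (TBig n x)) :
    chartFiber E e w = (E (e.symm w)).comap (bigChartEquiv he hw).toLinearMap :=
  rfl

theorem mem_fiber_iff (he : e ∈ IsManifold.maximalAtlas (𝓡 n) ∞ M) {x : M} (hx : x ∈ e.source)
    (E : (x : M) → Submodule ℝ (TBig n x)) (v : Model n) (η : Model n →L[ℝ] ℝ) :
    ((v, η) : TBig n x) ∈ E x ↔
      (chartDeriv e x v, η.comp (chartSymmDeriv e (e x))) ∈ chartFiber E e (e x) := by
  obtain ⟨w, hw, rfl⟩ : ∃ w ∈ e.target, e.symm w = x := ⟨e x, e.map_source hx, e.left_inv hx⟩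
  rw [e.right_inv hw, chartFiber_eq_comap he hw]
  have : ((v, η) : TBig n (e.symm w)) = bigChartEquiv he hw
      (chartDeriv e (e.symm w) v, η.comp (chartSymmDeriv e w)) :=
    ((bigChartEquiv he hw).apply_symm_apply (v, η)).symm
  rw [this]
  rfl

theorem chart_mem_chartFiber_iff (he : e ∈ IsManifold.maximalAtlas (𝓡 n) ∞ M) {w : Model n}
    (hw : w ∈ e.target) (E : (x : M) → Submodule ℝ (TBig n x)) (X : VField n M)
    (ξ : OneForm n M) : (chartVField e X w, chartOneForm e ξ w) ∈ chartFiber E e w ↔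
      (X (e.symm w), ξ (e.symm w)) ∈ E (e.symm w) := by
  have h := mem_fiber_iff he (e.map_target hw) E (X (e.symm w)) (ξ (e.symm w))
  rw [e.right_inv hw] at h
  exact h.symm

/-- The vector fields and 1-forms of a frame, read in a chart. -/
structure IsFlatFrame (S : Model n → Submodule ℝ (Model n × (Model n →L[ℝ] ℝ))) {k : ℕ}
    (B : Fin k → Model n → Model n × (Model n →L[ℝ] ℝ)) : Prop where
  contDiff : ∀ i, ContDiff ℝ ∞ (B i)
  linearIndependent : ∀ w, LinearIndependent ℝ fun i => B i w
  span_eq : ∀ w, Submodule.span ℝ (Set.range fun i => B i w) = S w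

theorem IsFrameOn.isFlatFrame [IsManifold (𝓡 n) ∞ M] {E : (x : M) → Submodule ℝ (TBig n x)}
    {U : Set M} {k : ℕ} {X : Fin k → VField n M} {ξ : Fin k → OneForm n M}
    (h : IsFrameOn E U X ξ) (he : e ∈ IsManifold.maximalAtlas (𝓡 n) ∞ M)
    (ht : e.target = Set.univ) (hU : e.source ⊆ U) :
    IsFlatFrame (chartFiber E e) fun i w => (chartVField e (X i) w, chartOneForm e (ξ i) w) := by
  have hw : ∀ w, w ∈ e.target := fun w => ht ▸ trivial
  have hB : ∀ i w, (chartVField e (X i) w, chartOneForm e (ξ i) w) =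
      (bigChartEquiv he (hw w)).symm (X i (e.symm w), ξ i (e.symm w)) := fun _ _ => rfl
  refine ⟨fun i => ?_, fun w => ?_, fun w => ?_⟩
  · refine contDiff_iff_contDiffAt.2 fun w => ContDiffAt.prodMk ?_ ?_
    · have := (contMDiffAt_vField_iff he (e.map_target (hw w)) (X i)).1
        (((h.smooth_fst i).mono hU).contMDiffAt (e.open_source.mem_nhds (e.map_target (hw w))))
      rwa [e.right_inv (hw w)] at this
    · have := (contMDiffAt_oneForm_iff he (e.map_target (hw w)) (ξ i)).1
        (((h.smooth_snd i).mono hU).contMDiffAt (e.open_source.mem_nhds (e.map_target (hw w))))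
      rwa [e.right_inv (hw w)] at this
  · simp only [hB]
    exact (h.linearIndependent _ (hU (e.map_target (hw w)))).map'
      (bigChartEquiv he (hw w)).symm.toLinearMap (LinearEquiv.ker _)
  · simp only [hB]
    rw [chartFiber_eq_comap he (hw w), ← h.span_eq _ (hU (e.map_target (hw w)))]
    refine Eq.trans ?_ (Submodule.map_equiv_eq_comap_symm (bigChartEquiv he (hw w)).symm _)
    rw [Submodule.map_span, ← Set.range_comp]
    rfl

theorem IsFlatFrame.isFrameOn [IsManifold (𝓡 n) ∞ M] {E : (x : M) → Submodule ℝ (TBig n x)}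
    {k : ℕ} {B : Fin k → Model n → Model n × (Model n →L[ℝ] ℝ)}
    (h : IsFlatFrame (chartFiber E e) B) (he : e ∈ IsManifold.maximalAtlas (𝓡 n) ∞ M) :
    IsFrameOn E e.source (fun i => extendVField e fun w => (B i w).1)
      (fun i => extendOneForm e fun w => (B i w).2) := by
  have hB : ∀ i w (hw : w ∈ e.target), ((extendVField e (fun w => (B i w).1) (e.symm w),
      extendOneForm e (fun w => (B i w).2) (e.symm w)) : TBig n (e.symm w)) =
      bigChartEquiv he hw (B i w) := by
    intro i w hw
    rw [extendVField_of_mem (e.map_target hw), extendOneForm_of_mem (e.map_target hw),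
      e.right_inv hw]
    rfl
  refine ⟨fun i x hx => ?_, fun i x hx => ?_, fun x hx => ?_, fun x hx => ?_⟩
  · refine ((contMDiffAt_vField_iff he hx _).2 ?_).contMDiffWithinAt
    refine (h.contDiff i).contDiffAt.fst.congr_of_eventuallyEq ?_
    filter_upwards [e.open_target.mem_nhds (e.map_source hx)] with w hw
    exact chartVField_extendVField he _ hw
  · refine ((contMDiffAt_oneForm_iff he hx _).2 ?_).contMDiffWithinAt
    refine (h.contDiff i).contDiffAt.snd.congr_of_eventuallyEq ?_
    filter_upwards [e.open_target.mem_nhds (e.map_source hx)] with w hw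
    exact chartOneForm_extendOneForm he _ hw
  all_goals
    obtain ⟨w, hw, rfl⟩ : ∃ w ∈ e.target, e.symm w = x := ⟨e x, e.map_source hx, e.left_inv hx⟩
    simp only [hB _ w hw]
  · exact (h.linearIndependent w).map' (bigChartEquiv he hw).toLinearMap (LinearEquiv.ker _)
  · have := congrArg (Submodule.map (bigChartEquiv he hw).toLinearMap) (h.span_eq w)
    rw [chartFiber_eq_comap he hw, Submodule.map_comap_eq_of_surjective
      (bigChartEquiv he hw).surjective, Submodule.map_span, ← Set.range_comp] at this
    exact this

end ChartFiber

/-! ### An arbitrary quotient map read in a foliated chart. -/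

section LeafSpace

variable {p q : ℕ} {M : Type u} [TopologicalSpace M] [ChartedSpace (Model (p + q)) M]
  {F : Foliation p q M} {e : OpenPartialHomeomorph M (Model (p + q))}
  {U : Set M} {Q : Type u} [TopologicalSpace Q] [ChartedSpace (Model q) Q] {π : M → Q}

/-- The differential of the projection onto a leaf space, read in a chart of the source. -/
noncomputable def leafSpaceDeriv (π : M → Q) (e : OpenPartialHomeomorph M (Model (p + q)))
    (w : Model (p + q)) : Model (p + q) →L[ℝ] Model q :=
  (show Model (p + q) →L[ℝ] Model q from
    mfderiv (𝓡 (p + q)) (𝓡 q) π (e.symm w)).comp (chartSymmDeriv e w)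

theorem IsFoliatedChart.leafSpace_add (he : IsFoliatedChart F e) (hπ : IsLeafSpace F U π)
    (hU : e.source ⊆ U) (w v : Model (p + q)) (hv : transProj p q v = 0) :
    π (e.symm (w + v)) = π (e.symm w) :=
  ((hπ.fiber_eq _ (hU (he.map_target _)) _ (hU (he.map_target _))).2
    (Relation.EqvGen.rel _ _ (he.leafCurve hU w v hv))).symm

theorem IsFoliatedChart.leafSpaceDeriv_eq_zero_iff (he : IsFoliatedChart F e)
    (hπ : IsLeafSpace F U π) (hU : e.source ⊆ U) (w v : Model (p + q)) :
    leafSpaceDeriv π e w v = 0 ↔ transProj p q v = 0 :=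
  (hπ.ker_eq _ (hU (he.map_target w)) (chartSymmDeriv e w v)).trans
    (he.chartSymmDeriv_mem_tangent_iff w v)

/-- In the chart the quotient map is invariant under the translation by `v`, whose differential is
the identity. -/
theorem IsFoliatedChart.leafSpaceDeriv_add (he : IsFoliatedChart F e)
    (hπ : IsLeafSpace F U π) (hU : e.source ⊆ U) (w v : Model (p + q))
    (hv : transProj p q v = 0) : leafSpaceDeriv π e (w + v) = leafSpaceDeriv π e w := by
  have hd : ∀ w, MDifferentiableAt (𝓡 (p + q)) (𝓡 q) π (e.symm w) := fun w =>
    ((hπ.smooth _ (hU (he.map_target w))).contMDiffAt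
      (hπ.isOpen.mem_nhds (hU (he.map_target w)))).mdifferentiableAt (by simp)
  have hs : ∀ w, MDifferentiableAt (𝓡 (p + q)) (𝓡 (p + q)) e.symm w := fun w =>
    (contMDiffAt_chart_symm he.mem (he.mem_target w)).mdifferentiableAt (by simp)
  have hc : ∀ w, mfderiv (𝓡 (p + q)) (𝓡 q) (π ∘ e.symm) w = leafSpaceDeriv π e w := fun w =>
    mfderiv_comp w (hd w) (hs w)
  have hτ : HasFDerivAt (fun z : Model (p + q) => z + v)
      (ContinuousLinearMap.id ℝ (Model (p + q))) w := (hasFDerivAt_id w).add_const v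
  have hcomp : (π ∘ e.symm) ∘ (fun z => z + v) = π ∘ e.symm :=
    funext fun z => he.leafSpace_add hπ hU z v hv
  have h1 := mfderiv_comp w (I := 𝓡 (p + q)) (I' := 𝓡 (p + q)) (I'' := 𝓡 q)
    (g := π ∘ e.symm) (f := fun z => z + v) ((hd (w + v)).comp (w + v) (hs (w + v)))
    hτ.hasMFDerivAt.mdifferentiableAt
  rw [hcomp] at h1
  refine ((hc w).symm.trans (h1.trans ?_)).symm
  refine (congrArg (fun L : Model (p + q) →L[ℝ] Model (p + q) =>
    (show Model (p + q) →L[ℝ] Model q from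
      mfderiv (𝓡 (p + q)) (𝓡 q) (π ∘ e.symm) (w + v)).comp L) hτ.hasMFDerivAt.mfderiv).trans ?_
  exact (ContinuousLinearMap.comp_id _).trans (hc (w + v))

end LeafSpace

/-! ### Adapted charts, obtained from foliatedness or from projectable bases. -/

section Adapted

variable {p q k : ℕ} {M : Type u} [TopologicalSpace M] [ChartedSpace (Model (p + q)) M]
  [IsManifold (𝓡 (p + q)) ∞ M]

/-- A foliated chart in which the subbundle `E` contains the vertical vectors, consists of pairs
whose second component vanishes on the vertical vectors, and is constant along the leaves. -/
structure IsAdaptedChart (F : Foliation p q M) (E : BigSubbundle (p + q) M k)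
    (e : OpenPartialHomeomorph M (Model (p + q))) : Prop extends IsFoliatedChart F e where
  vertical_mem : ∀ w v, transProj p q v = 0 → (v, 0) ∈ chartFiber E.fiber e w
  apply_vertical : ∀ w, ∀ b ∈ chartFiber E.fiber e w, ∀ v, transProj p q v = 0 → b.2 v = 0
  le_add : ∀ w v, transProj p q v = 0 →
    chartFiber E.fiber e w ≤ chartFiber E.fiber e (w + v)

/-- There are arbitrarily small adapted charts around each point. -/
def HasAdaptedCharts (F : Foliation p q M) (E : BigSubbundle (p + q) M k) : Prop :=
  ∀ x₀ : M, ∀ W ∈ 𝓝 x₀, ∃ e, IsAdaptedChart F E e ∧ x₀ ∈ e.source ∧ e.source ⊆ W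

variable {F : Foliation p q M} {E : BigSubbundle (p + q) M k}
  {e : OpenPartialHomeomorph M (Model (p + q))}

/-- In a foliated chart, `E` at `w` is determined by `π` and `dπ` at `w` alone, and both are
constant in vertical directions. Vertical vectors are the kernel of `dπ`, so they lie in `E` (take
`α = 0`) and are killed by all pullbacks. -/
theorem BigSubbundle.IsFoliated.hasAdaptedCharts (h : E.IsFoliated F) :
    HasAdaptedCharts F E := by
  intro x₀ W hW
  obtain ⟨U, hUo, hxU, Q, _, _, _, _, π, hπ, l, Δ, hΔ⟩ := h x₀
  obtain ⟨e, he, hx, hsub⟩ := exists_isFoliatedChart F x₀ (Filter.inter_mem hW (hUo.mem_nhds hxU))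
  have hU : e.source ⊆ U := hsub.trans Set.inter_subset_right
  let fib : Q → Submodule ℝ (Model q × (Model q →L[ℝ] ℝ)) := Δ.fiber
  have key : ∀ w (b : Model (p + q) × (Model (p + q) →L[ℝ] ℝ)), b ∈ chartFiber E.fiber e w ↔
      ∃ α : Model q →L[ℝ] ℝ, (leafSpaceDeriv π e w b.1, α) ∈ fib (π (e.symm w)) ∧
        b.2 = α.comp (leafSpaceDeriv π e w) := by
    intro w b
    refine (hΔ _ (hU (he.map_target w)) _).trans (exists_congr fun α => and_congr Iff.rfl ?_)
    constructor
    · intro h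
      have h' := congrArg (fun L : Model (p + q) →L[ℝ] ℝ => L.comp (chartSymmDeriv e w)) h
      refine Eq.trans ?_ h'
      exact ((ContinuousLinearMap.comp_assoc _ _ _).trans
        (by rw [chartDeriv_comp he.mem (he.mem_target w)]; rfl)).symm
    · intro h
      have h0 := chartSymmDeriv_comp he.mem (he.map_target w)
      rw [he.right_inv] at h0
      have h' := congrArg
        (fun L : Model (p + q) →L[ℝ] ℝ => L.comp (chartDeriv e (e.symm w))) h
      refine h'.trans ?_
      exact congrArg (fun L : Model (p + q) →L[ℝ] Model (p + q) =>
        (show Model (p + q) →L[ℝ] ℝ from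
          α.comp (mfderiv (𝓡 (p + q)) (𝓡 q) π (e.symm w))).comp L) h0
  refine ⟨e, ⟨he, fun w v hv => ?_, fun w b hb v hv => ?_, fun w v hv b hb => ?_⟩, hx,
    hsub.trans Set.inter_subset_left⟩
  · refine (key _ _).2 ⟨0, ?_, ?_⟩
    · rw [(he.leafSpaceDeriv_eq_zero_iff hπ hU w v).2 hv]
      exact (fib _).zero_mem
    · exact (ContinuousLinearMap.zero_comp _).symm
  · obtain ⟨α, -, h2⟩ := (key _ _).1 hb
    rw [h2, ContinuousLinearMap.comp_apply, (he.leafSpaceDeriv_eq_zero_iff hπ hU w v).2 hv,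
      map_zero]
  · obtain ⟨α, h1, h2⟩ := (key _ _).1 hb
    refine (key _ _).2 ⟨α, ?_, ?_⟩
    · rwa [he.leafSpaceDeriv_add hπ hU w v hv, he.leafSpace_add hπ hU w v hv]
    · rwa [he.leafSpaceDeriv_add hπ hU w v hv]

theorem BigSubbundle.ContainsTangent.vertical_mem (h : E.ContainsTangent F)
    (he : IsFoliatedChart F e) (w v : Model (p + q)) (hv : transProj p q v = 0) :
    (v, 0) ∈ chartFiber E.fiber e w := by
  have h1 : ((chartSymmDeriv e w v, (0 : Model (p + q) →L[ℝ] ℝ).comp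
      (chartDeriv e (e.symm w))) : TBig (p + q) (e.symm w)) = (chartSymmDeriv e w v, 0) :=
    Prod.ext rfl (ContinuousLinearMap.zero_comp _)
  exact mem_chartFiber.2 (h1 ▸ h _ _ ((he.chartSymmDeriv_mem_tangent_iff w v).2 hv))

/-- Under a vertical translation the forms of a projectable basis do not change, and its vector
fields change by vertical vectors only, which belong to `E` by a). -/
theorem BigSubbundle.HasProjectableBases.hasAdaptedCharts (hT : E.ContainsTangent F)
    (h : E.HasProjectableBases F) : HasAdaptedCharts F E := by
  intro x₀ W hW
  obtain ⟨U, hUo, hxU, Q, _, _, _, _, π, hπ, X, ξ, hB, hproj⟩ := h x₀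
  obtain ⟨e, he, hx, hsub⟩ := exists_isFoliatedChart F x₀ (Filter.inter_mem hW (hUo.mem_nhds hxU))
  have hU : e.source ⊆ U := hsub.trans Set.inter_subset_right
  have hf := hB.isFlatFrame he.mem he.target_eq hU
  choose V hVs hV using fun i => (hproj i).1
  choose μ hμs hμ using fun i => (hproj i).2
  have hB1 : ∀ i w, leafSpaceDeriv π e w (chartVField e (X i) w) =
      (show Model q from V i (π (e.symm w))) := by
    intro i w
    rw [leafSpaceDeriv, ContinuousLinearMap.comp_apply,
      chartSymmDeriv_chartVField he.mem (he.mem_target w)]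
    exact hV i _ (hU (he.map_target w))
  have hB2 : ∀ i w, chartOneForm e (ξ i) w =
      (show Model q →L[ℝ] ℝ from μ i (π (e.symm w))).comp (leafSpaceDeriv π e w) := by
    intro i w
    exact congrArg (fun L : Model (p + q) →L[ℝ] ℝ => L.comp (chartSymmDeriv e w))
      (hμ i _ (hU (he.map_target w)))
  have hadd : ∀ i w v, transProj p q v = 0 →
      leafSpaceDeriv π e w (chartVField e (X i) (w + v)) =
        leafSpaceDeriv π e w (chartVField e (X i) w) ∧
      chartOneForm e (ξ i) (w + v) = chartOneForm e (ξ i) w := by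
    intro i w v hv
    constructor
    · rw [hB1, ← he.leafSpaceDeriv_add hπ hU w v hv, hB1]
      rw [he.leafSpace_add hπ hU w v hv]
    · rw [hB2, hB2, he.leafSpaceDeriv_add hπ hU w v hv, he.leafSpace_add hπ hU w v hv]
  have hv0 := fun w v => hT.vertical_mem he w v
  refine ⟨e, ⟨he, hv0, fun w b hb v hv => ?_, fun w v hv b hb => ?_⟩, hx,
    hsub.trans Set.inter_subset_left⟩
  all_goals
    rw [← hf.span_eq, Submodule.mem_span_range_iff_exists_fun] at hb
    obtain ⟨c, rfl⟩ := hb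
  · rw [Prod.snd_sum, sum_apply]
    refine Finset.sum_eq_zero fun i _ => ?_
    rw [Prod.smul_snd, smul_apply, hB2, ContinuousLinearMap.comp_apply,
      (he.leafSpaceDeriv_eq_zero_iff hπ hU w v).2 hv, map_zero, smul_zero]
  · have h1 : ∑ i, c i • (chartVField e (X i) (w + v), chartOneForm e (ξ i) (w + v)) ∈
        chartFiber E.fiber e (w + v) := by
      rw [← hf.span_eq]
      exact Submodule.sum_mem _ fun i _ => Submodule.smul_mem _ _
        (Submodule.subset_span (Set.mem_range_self i))
    -- This is the vertical error made when the frame at `w` is replaced by the frame at `w + v`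
    -- with the same coefficients.
    have h2 := hv0 (w + v) (∑ i, c i • (chartVField e (X i) w - chartVField e (X i) (w + v))) (by
      rw [← he.leafSpaceDeriv_eq_zero_iff hπ hU w, map_sum]
      refine Finset.sum_eq_zero fun i _ => ?_
      rw [map_smul, map_sub, (hadd i w v hv).1, sub_self, smul_zero])
    convert Submodule.add_mem _ h1 h2 using 1
    refine Prod.ext ?_ ?_
    · simp only [Prod.fst_add, Prod.fst_sum, Prod.smul_fst, ← Finset.sum_add_distrib, smul_sub,
        add_sub_cancel]
    · simp only [Prod.snd_add, Prod.snd_sum, Prod.smul_snd, (hadd _ w v hv).2, add_zero]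

end Adapted

/-! ### Smooth fields on the model leaf space. -/

section LeafModelFields

variable {q : ℕ}

theorem smoothVFieldOn_leafModel {f : Model q → Model q} {y₀ : LeafModel.{u} q}
    (hf : ContDiffAt ℝ ∞ f (leafModelChart q y₀)) :
    ContMDiffAt (𝓡 q) (𝓡 q).tangent ∞
      (fun y => (⟨y, f (leafModelChart q y)⟩ : TangentBundle (𝓡 q) (LeafModel.{u} q))) y₀ := by
  refine (contMDiffAt_vField_iff (leafModelChart_mem q) (x := y₀) trivial _).2 ?_
  have : chartVField (leafModelChart.{u} q) (fun y => f (leafModelChart q y)) = f := by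
    funext w
    exact congrArg (fun L : Model q →L[ℝ] Model q => L (f w)) (chartDeriv_leafModelChart q _)
  rwa [this]

theorem smoothOneFormOn_leafModel {f : Model q → (Model q →L[ℝ] ℝ)} {y₀ : LeafModel.{u} q}
    (hf : ContDiffAt ℝ ∞ f (leafModelChart q y₀)) :
    ContMDiffAt (𝓡 q) ((𝓡 q).prod 𝓘(ℝ, Model q →L[ℝ] ℝ)) ∞
      (fun y => Bundle.TotalSpace.mk' (Model q →L[ℝ] ℝ)
        (E := fun y : LeafModel.{u} q => TangentSpace (𝓡 q) y →L[ℝ]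
          Bundle.Trivial (LeafModel.{u} q) ℝ y) y (f (leafModelChart q y))) y₀ := by
  refine (contMDiffAt_oneForm_iff (leafModelChart_mem q) (x := y₀) trivial
    (fun y => f (leafModelChart q y))).2 ?_
  have : chartOneForm (leafModelChart.{u} q) (fun y => f (leafModelChart q y)) = f := by
    funext w
    exact congrArg (fun L : Model q →L[ℝ] Model q => (f w).comp L)
      (chartSymmDeriv_leafModelChart q _)
  rwa [this]

end LeafModelFields

/-! ### From adapted charts to projectable bases and to the quotient bundle. -/

section Adapted

variable {p q k : ℕ} {M : Type u} [TopologicalSpace M] [ChartedSpace (Model (p + q)) M]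
  [IsManifold (𝓡 (p + q)) ∞ M]
  {F : Foliation p q M} {E : BigSubbundle (p + q) M k}
  {e : OpenPartialHomeomorph M (Model (p + q))}

theorem transProj_sub_transIncl (w : Model (p + q)) :
    transProj p q (w - transIncl p q (transProj p q w)) = 0 := by
  rw [map_sub, transProj_transIncl, sub_self]

theorem comp_transIncl_comp_transProj {η : Model (p + q) →L[ℝ] ℝ}
    (hη : ∀ v, transProj p q v = 0 → η v = 0) :
    (η.comp (transIncl p q)).comp (transProj p q) = η := by
  ext v
  have := hη _ (transProj_sub_transIncl v)
  rw [map_sub, sub_eq_zero] at this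
  exact this.symm

theorem IsAdaptedChart.chartFiber_eq (he : IsAdaptedChart F E e) {w z : Model (p + q)}
    (h : transProj p q w = transProj p q z) :
    chartFiber E.fiber e w = chartFiber E.fiber e z := by
  have key : ∀ w z, transProj p q w = transProj p q z →
      chartFiber E.fiber e w ≤ chartFiber E.fiber e z := by
    intro w z h
    have := he.le_add w (z - w) (by rw [map_sub, h, sub_self])
    rwa [add_sub_cancel] at this
  exact le_antisymm (key w z h) (key z w h.symm)

theorem IsAdaptedChart.chartFiber_transIncl (he : IsAdaptedChart F E e) (w : Model (p + q)) :
    chartFiber E.fiber e (transIncl p q (transProj p q w)) = chartFiber E.fiber e w :=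
  he.chartFiber_eq (by rw [transProj_transIncl])

theorem HasAdaptedCharts.exists_frame (h : HasAdaptedCharts F E) (x₀ : M) :
    ∃ e, IsAdaptedChart F E e ∧ x₀ ∈ e.source ∧
      ∃ B : Fin k → Model (p + q) → Model (p + q) × (Model (p + q) →L[ℝ] ℝ),
        IsFlatFrame (chartFiber E.fiber e) B := by
  obtain ⟨U, hU, hx, X, ξ, hB⟩ := E.exists_frame x₀
  obtain ⟨e, he, hxe, hsub⟩ := h x₀ U (hU.mem_nhds hx)
  exact ⟨e, he, hxe, _, hB.isFlatFrame he.mem he.target_eq hsub⟩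

theorem HasAdaptedCharts.containsTangent (h : HasAdaptedCharts F E) : E.ContainsTangent F := by
  intro x v hv
  obtain ⟨e, he, hx, -⟩ := h x Set.univ univ_mem
  refine (mem_fiber_iff he.mem hx E.fiber v 0).2 ?_
  rw [ContinuousLinearMap.zero_comp]
  exact he.vertical_mem _ _ ((he.mem_tangent_iff x hx v).1 hv)

/-- Freezing a frame at its values on the transversal keeps it a frame, since the fibres are
constant along the plaques. Its coefficients then depend on the transverse coordinates only, and its
covectors kill vertical vectors, so they come from `ℝ^q`. -/
theorem HasAdaptedCharts.hasProjectableBases (h : HasAdaptedCharts F E) :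
    E.HasProjectableBases F := by
  intro x₀
  obtain ⟨e, he, hx, B, hB⟩ := h.exists_frame x₀
  have hB' : IsFlatFrame (chartFiber E.fiber e)
      (fun i w => B i (transIncl p q (transProj p q w))) :=
    ⟨fun i => (hB.contDiff i).comp ((transIncl p q).contDiff.comp (transProj p q).contDiff),
      fun w => hB.linearIndependent _,
      fun w => (hB.span_eq _).trans (he.chartFiber_transIncl w)⟩
  refine ⟨e.source, e.open_source, hx, LeafModel q, inferInstance, inferInstance, inferInstance,
    inferInstance, leafProj e, he.toIsFoliatedChart.isLeafSpace, _, _, hB'.isFrameOn he.mem,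
    fun i => ⟨?_, ?_⟩⟩
  · refine ⟨fun y => transProj p q (B i (transIncl p q (leafModelChart q y))).1,
      fun y _ => (smoothVFieldOn_leafModel (f := fun y => transProj p q (B i (transIncl p q y)).1)
        ?_).contMDiffWithinAt, fun x hx => ?_⟩
    · exact ((transProj p q).contDiff.comp
        ((hB.contDiff i).comp (transIncl p q).contDiff).fst).contDiffAt
    · refine (he.toIsFoliatedChart.mfderiv_leafProj hx _).trans ?_
      rw [extendVField_of_mem hx]
      refine congrArg (transProj p q) ?_
      have := chartDeriv_chartSymmDeriv he.mem (he.mem_target (e x))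
        (B i (transIncl p q (transProj p q (e x)))).1
      rwa [e.left_inv hx] at this
  · refine ⟨fun y => (B i (transIncl p q (leafModelChart q y))).2.comp (transIncl p q),
      fun y _ => (smoothOneFormOn_leafModel
        (f := fun y => (B i (transIncl p q y)).2.comp (transIncl p q)) ?_).contMDiffWithinAt,
      fun x hx => ?_⟩
    · exact (((hB.contDiff i).comp (transIncl p q).contDiff).snd.clm_comp
        contDiff_const).contDiffAt
    · rw [extendOneForm_of_mem hx]
      have h1 : (mfderiv (𝓡 (p + q)) (𝓡 q) (leafProj e) x : Model (p + q) →L[ℝ] Model q) =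
          (transProj p q).comp (chartDeriv e x) :=
        ContinuousLinearMap.ext fun v => he.toIsFoliatedChart.mfderiv_leafProj hx v
      refine Eq.trans ?_ (congrArg (fun L : Model (p + q) →L[ℝ] Model q =>
        (((B i (transIncl p q (transProj p q (e x)))).2.comp (transIncl p q)).comp L)) h1).symm
      rw [← ContinuousLinearMap.comp_assoc, comp_transIncl_comp_transProj]
      refine he.apply_vertical (transIncl p q (transProj p q (e x))) _ ?_
      rw [← hB.span_eq]
      exact Submodule.subset_span (Set.mem_range_self i)

variable (p q) in
/-- The restriction to a transversal of a vector and of a covector. -/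
noncomputable def transversePart :
    (Model (p + q) × (Model (p + q) →L[ℝ] ℝ)) →L[ℝ] (Model q × (Model q →L[ℝ] ℝ)) :=
  (transProj p q).prodMap ((ContinuousLinearMap.compL ℝ _ _ ℝ).flip (transIncl p q))

@[simp]
theorem transversePart_apply (b : Model (p + q) × (Model (p + q) →L[ℝ] ℝ)) :
    transversePart p q b = (transProj p q b.1, b.2.comp (transIncl p q)) :=
  rfl

/-- Two pairs with the same transverse part, whose covectors kill vertical vectors, differ by a
vertical vector, and that vector lies in `E`. -/
theorem IsAdaptedChart.mem_iff_transversePart_mem (he : IsAdaptedChart F E e)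
    (w : Model (p + q)) (b : Model (p + q) × (Model (p + q) →L[ℝ] ℝ)) :
    b ∈ chartFiber E.fiber e w ↔ (∀ v, transProj p q v = 0 → b.2 v = 0) ∧
      transversePart p q b ∈ (chartFiber E.fiber e w).map (transversePart p q).toLinearMap := by
  constructor
  · intro hb
    exact ⟨he.apply_vertical w b hb, Submodule.mem_map_of_mem hb⟩
  · rintro ⟨hb, c, hc, hcb⟩
    have h1 : transProj p q c.1 = transProj p q b.1 := congrArg Prod.fst hcb
    have h2 : c.2.comp (transIncl p q) = b.2.comp (transIncl p q) := congrArg Prod.snd hcb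
    have h3 : b = c + (b.1 - c.1, 0) := by
      refine Prod.ext (by simp) ?_
      rw [Prod.snd_add, add_zero, ← comp_transIncl_comp_transProj hb, ← h2,
        comp_transIncl_comp_transProj (he.apply_vertical w c hc)]
    rw [h3]
    exact Submodule.add_mem _ hc (he.vertical_mem w _ (by rw [map_sub, h1, sub_self]))

/-- Rank–nullity: the kernel of the transverse part on a fibre of `E` is exactly the space of
vertical vectors. Hence the transverse parts have constant dimension, as a bundle requires. -/
theorem IsAdaptedChart.finrank_map_transversePart (he : IsAdaptedChart F E e)
    {B : Fin k → Model (p + q) → Model (p + q) × (Model (p + q) →L[ℝ] ℝ)}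
    (hB : IsFlatFrame (chartFiber E.fiber e) B) (w : Model (p + q)) :
    Module.finrank ℝ ((chartFiber E.fiber e w).map (transversePart p q).toLinearMap) +
      Module.finrank ℝ (LinearMap.ker (transProj p q).toLinearMap) = k := by
  have h1 := LinearMap.finrank_range_add_finrank_ker (K := ℝ) (V := chartFiber E.fiber e w)
    (V₂ := Model q × (Model q →L[ℝ] ℝ))
    ((transversePart p q).toLinearMap.domRestrict (chartFiber E.fiber e w))
  have h2 : Module.finrank ℝ (chartFiber E.fiber e w) = k := by
    rw [← hB.span_eq w, finrank_span_eq_card (hB.linearIndependent w), Fintype.card_fin]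
  rw [LinearMap.range_domRestrict, h2] at h1
  refine Eq.trans (congrArg (_ + ·) ?_) h1
  refine LinearEquiv.finrank_eq (LinearEquiv.ofBijective
    (LinearMap.codRestrict _ ((LinearMap.inl ℝ (Model (p + q)) (Model (p + q) →L[ℝ] ℝ)
      ∘ₗ (LinearMap.ker (transProj p q).toLinearMap).subtype).codRestrict
        (chartFiber E.fiber e w) fun v => he.vertical_mem w v.1 v.2) fun v => ?_) ⟨?_, ?_⟩)
  · refine Prod.ext v.2 ?_
    exact ContinuousLinearMap.zero_comp _
  · intro v v' h
    have := congrArg (fun b => b.1.1.1) h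
    exact Subtype.ext this
  · rintro ⟨⟨b, hb⟩, hb'⟩
    have h3 : transProj p q b.1 = 0 := congrArg Prod.fst hb'
    have h4 : b.2.comp (transIncl p q) = 0 := congrArg Prod.snd hb'
    have h5 : b.2 = 0 := by
      rw [← comp_transIncl_comp_transProj (he.apply_vertical w b hb), h4,
        ContinuousLinearMap.zero_comp]
    refine ⟨⟨b.1, h3⟩, Subtype.ext (Subtype.ext (Prod.ext rfl h5.symm))⟩

/-- A smooth family of spanning vectors of a family of subspaces of constant dimension contains
a basis near each point. -/
theorem exists_eventually_basis {D V : Type*} [TopologicalSpace D] [NormedAddCommGroup V]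
    [NormedSpace ℝ V] [FiniteDimensional ℝ V] {k l : ℕ} {s : Fin k → D → V}
    (hs : ∀ i, Continuous (s i)) {S : D → Submodule ℝ V}
    (hspan : ∀ y, Submodule.span ℝ (Set.range fun i => s i y) = S y)
    (hl : ∀ y, Module.finrank ℝ (S y) = l) (y₀ : D) :
    ∃ a : Fin l → Fin k, ∀ᶠ y in 𝓝 y₀, LinearIndependent ℝ (fun j => s (a j) y) ∧
      Submodule.span ℝ (Set.range fun j => s (a j) y) = S y := by
  obtain ⟨κ, a, ha, hsp, hli⟩ := exists_linearIndependent' ℝ (fun i => s i y₀)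
  have : Fintype κ := Fintype.ofInjective a ha
  have hcard : Fintype.card κ = l := by
    rw [← hl y₀, ← hspan y₀, ← hsp, finrank_span_eq_card hli]
  let ε : Fin l ≃ κ := (Fintype.equivFinOfCardEq hcard).symm
  have hli' : LinearIndependent ℝ (fun j => s (a (ε j)) y₀) := hli.comp ε ε.injective
  have hcont : Continuous fun y => fun j => s (a (ε j)) y := continuous_pi fun j => hs _
  refine ⟨fun j => a (ε j), ?_⟩
  -- Linear independence is an open condition; the constant dimension then forces the chosen vectors
  -- to span.
  filter_upwards [hcont.continuousAt.eventually hli'.eventually] with y hy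
  refine ⟨hy, Submodule.eq_of_le_of_finrank_eq ?_ ?_⟩
  · rw [← hspan y]
    exact Submodule.span_mono (Set.range_subset_iff.2 fun j => Set.mem_range_self _)
  · rw [hl, finrank_span_eq_card hy, Fintype.card_fin]

/-- The bundle `Δ` at `y` is the transverse part of the fibre of `E` at the point of the transversal
over `y`. The transverse parts of a frame of `E` span it, and locally a fixed subfamily of them is a
frame. -/
theorem HasAdaptedCharts.isFoliated (h : HasAdaptedCharts F E) : E.IsFoliated F := by
  intro x₀
  obtain ⟨e, he, hx, B, hB⟩ := h.exists_frame x₀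
  let S : Model q → Submodule ℝ (Model q × (Model q →L[ℝ] ℝ)) := fun y =>
    (chartFiber E.fiber e (transIncl p q y)).map (transversePart p q).toLinearMap
  let s : Fin k → Model q → Model q × (Model q →L[ℝ] ℝ) := fun i y =>
    transversePart p q (B i (transIncl p q y))
  have hs : ∀ i, ContDiff ℝ ∞ (s i) := fun i =>
    (transversePart p q).contDiff.comp ((hB.contDiff i).comp (transIncl p q).contDiff)
  have hspan : ∀ y, Submodule.span ℝ (Set.range fun i => s i y) = S y := by
    intro y
    simp only [S, s]
    rw [← hB.span_eq, Submodule.map_span, ← Set.range_comp]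
    rfl
  have hl : ∀ y, Module.finrank ℝ (S y) =
      k - Module.finrank ℝ (LinearMap.ker (transProj p q).toLinearMap) := fun y =>
    Nat.eq_sub_of_add_eq (he.finrank_map_transversePart hB _)
  let Δ : BigSubbundle q (LeafModel.{u} q)
      (k - Module.finrank ℝ (LinearMap.ker (transProj p q).toLinearMap)) :=
    { fiber := fun y => S (leafModelChart q y)
      exists_frame := by
        intro y₀
        obtain ⟨a, ha⟩ := exists_eventually_basis (fun i => (hs i).continuous) hspan hl
          (leafModelChart q y₀)
        obtain ⟨V, hV, hVo, hyV⟩ := eventually_nhds_iff.1 ha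
        refine ⟨leafModelChart q ⁻¹' V, hVo.preimage (Homeomorph.ulift.{u}).continuous, hyV,
          fun j y => (s (a j) (leafModelChart q y)).1, fun j y => (s (a j) (leafModelChart q y)).2,
          fun j y _ => ?_, fun j y _ => ?_, fun y hy => (hV _ hy).1, fun y hy => (hV _ hy).2⟩
        · exact (smoothVFieldOn_leafModel (f := fun y => (s (a j) y).1)
            (hs (a j)).fst.contDiffAt).contMDiffWithinAt
        · exact (smoothOneFormOn_leafModel (f := fun y => (s (a j) y).2)
            (hs (a j)).snd.contDiffAt).contMDiffWithinAt }
  refine ⟨e.source, e.open_source, hx, LeafModel q, inferInstance, inferInstance, inferInstance,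
    inferInstance, leafProj e, he.toIsFoliatedChart.isLeafSpace, _, Δ, fun x hx => ?_⟩
  have hD : (mfderiv (𝓡 (p + q)) (𝓡 q) (leafProj e) x : Model (p + q) →L[ℝ] Model q) =
      (transProj p q).comp (chartDeriv e x) :=
    ContinuousLinearMap.ext fun v => he.toIsFoliatedChart.mfderiv_leafProj hx v
  have key : ∀ (v : Model (p + q)) (η : Model (p + q) →L[ℝ] ℝ),
      ((v, η) : TBig (p + q) x) ∈ E.fiber x ↔ ∃ α : Model q →L[ℝ] ℝ,
        ((transProj p q).comp (chartDeriv e x) v, α) ∈ S (transProj p q (e x)) ∧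
          η = α.comp ((transProj p q).comp (chartDeriv e x)) := by
    intro v η
    rw [mem_fiber_iff he.mem hx, he.mem_iff_transversePart_mem]
    have hS : S (transProj p q (e x)) =
        (chartFiber E.fiber e (e x)).map (transversePart p q).toLinearMap := by
      simp only [S]
      rw [he.chartFiber_transIncl]
    rw [hS]
    constructor
    · rintro ⟨h1, h2⟩
      refine ⟨(η.comp (chartSymmDeriv e (e x))).comp (transIncl p q), h2, ?_⟩
      rw [← ContinuousLinearMap.comp_assoc, comp_transIncl_comp_transProj h1,
        ContinuousLinearMap.comp_assoc, chartSymmDeriv_comp he.mem hx, ContinuousLinearMap.comp_id]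
    · rintro ⟨α, h1, h2⟩
      have h3 : η.comp (chartSymmDeriv e (e x)) = α.comp (transProj p q) := by
        have := chartDeriv_comp he.mem (he.mem_target (e x))
        rw [e.left_inv hx] at this
        rw [h2, ContinuousLinearMap.comp_assoc, ContinuousLinearMap.comp_assoc, this,
          ContinuousLinearMap.comp_id]
      rw [h3]
      refine ⟨fun v hv => by rw [ContinuousLinearMap.comp_apply, hv, map_zero], ?_⟩
      rw [transversePart_apply, ContinuousLinearMap.comp_assoc, transProj_comp_transIncl,
        ContinuousLinearMap.comp_id]
      exact h1
  intro w
  rw [← hD] at key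
  exact key w.1 w.2

end Adapted

/-! ### Constancy of the span of curves whose derivatives stay in their span. -/

section LinearODE

variable {V W : Type*} [NormedAddCommGroup V] [NormedSpace ℝ V] [NormedAddCommGroup W]
  [NormedSpace ℝ W]

/-- Difference quotients stay in the subspace, which is closed. -/
theorem mem_submodule_of_hasDerivAt [FiniteDimensional ℝ W] {c : ℝ → W} {c' : W} {t : ℝ}
    (hc : HasDerivAt c c' t) (S : Submodule ℝ W) (hS : ∀ s, c s ∈ S) : c' ∈ S := by
  refine S.closed_of_finiteDimensional.mem_of_tendsto (hasDerivAt_iff_tendsto_slope.1 hc)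
    (Eventually.of_forall fun s => ?_)
  exact S.smul_mem _ (S.sub_mem (hS s) (hS t))

theorem fderiv_mem_submodule [FiniteDimensional ℝ W] {b : V → W} {w v : V}
    (hb : DifferentiableAt ℝ b w) (S : Submodule ℝ W) (hS : ∀ t : ℝ, b (w + t • v) ∈ S) :
    fderiv ℝ b w v ∈ S := by
  have hline : HasDerivAt (fun t : ℝ => w + t • v) v 0 := by
    simpa using ((hasDerivAt_id (0 : ℝ)).smul_const v).const_add w
  have hb' : HasFDerivAt b (fderiv ℝ b w) ((fun t : ℝ => w + t • v) 0) := by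
    simpa using hb.hasFDerivAt
  exact mem_submodule_of_hasDerivAt (hb'.comp_hasDerivAt 0 hline) S hS

/-- If linearly independent curves span their derivatives, then the space that they span does
not grow. -/
theorem span_le_of_deriv_mem_span [FiniteDimensional ℝ W] {k : ℕ} {b b' : Fin k → ℝ → W}
    (hb : ∀ i t, HasDerivAt (b i) (b' i t) t) (hb' : ∀ i, Continuous (b' i))
    (hli : ∀ t, LinearIndependent ℝ fun i => b i t)
    (hmem : ∀ i t, b' i t ∈ Submodule.span ℝ (Set.range fun i => b i t)) :
    Submodule.span ℝ (Set.range fun i => b i 1) ≤ Submodule.span ℝ (Set.range fun i => b i 0) := by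
  have hcb : ∀ i, Continuous (b i) := fun i =>
    continuous_iff_continuousAt.2 fun t => (hb i t).continuousAt
  -- A uniform lower bound for the frame, by compactness of `[0, 1]` times the unit sphere. It
  -- bounds the coefficients of `b' i t` in the frame, so their continuity in `t` is not needed.
  obtain ⟨m, hm, hmb⟩ : ∃ m : ℝ, 0 < m ∧ ∀ t ∈ Set.Icc (0 : ℝ) 1, ∀ c : Fin k → ℝ,
      m * ‖c‖ ≤ ‖∑ i, c i • b i t‖ := by
    have hK : IsCompact (Set.Icc (0 : ℝ) 1 ×ˢ Metric.sphere (0 : Fin k → ℝ) 1) :=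
      isCompact_Icc.prod (isCompact_sphere _ _)
    have hcont : Continuous fun x : ℝ × (Fin k → ℝ) => ‖∑ i, x.2 i • b i x.1‖ := by
      refine continuous_norm.comp (continuous_finsetSum _ fun i _ => ?_)
      exact ((continuous_apply i).comp continuous_snd).smul ((hcb i).comp continuous_fst)
    obtain ⟨m, hm, hmb⟩ : ∃ m : ℝ, 0 < m ∧
        ∀ x ∈ Set.Icc (0 : ℝ) 1 ×ˢ Metric.sphere (0 : Fin k → ℝ) 1,
          m ≤ ‖∑ i, x.2 i • b i x.1‖ := by
      -- The sphere is empty when `k = 0`.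
      rcases (Set.Icc (0 : ℝ) 1 ×ˢ Metric.sphere (0 : Fin k → ℝ) 1).eq_empty_or_nonempty with h | h
      · exact ⟨1, one_pos, by simp [h]⟩
      · obtain ⟨x, hx, hmin⟩ := hK.exists_isMinOn h hcont.continuousOn
        refine ⟨_, norm_pos_iff.2 fun h0 => ?_, fun y hy => hmin hy⟩
        have h1 : x.2 = 0 := funext (Fintype.linearIndependent_iff.1 (hli x.1) x.2 h0)
        have h2 := hx.2
        rw [h1] at h2
        simp at h2
    refine ⟨m, hm, fun t ht c => ?_⟩
    rcases eq_or_ne c 0 with rfl | hc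
    · simp
    · have hc' : 0 < ‖c‖ := norm_pos_iff.2 hc
      have h1 := hmb (t, ‖c‖⁻¹ • c) ⟨ht, by
        rw [mem_sphere_zero_iff_norm, norm_smul, norm_inv, norm_norm, inv_mul_cancel₀ hc'.ne']⟩
      have h2 : ∑ i, (‖c‖⁻¹ • c) i • b i t = ‖c‖⁻¹ • ∑ i, c i • b i t := by
        simp [Finset.smul_sum, smul_smul]
      simp only [h2, norm_smul, norm_inv, norm_norm] at h1
      rwa [inv_mul_eq_div, le_div_iff₀ hc'] at h1
  obtain ⟨C, hC⟩ : ∃ C : ℝ, ∀ t ∈ Set.Icc (0 : ℝ) 1, ∀ i, ‖b' i t‖ ≤ C := by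
    obtain ⟨C, hC⟩ := isCompact_Icc.exists_bound_of_continuousOn (s := Set.Icc (0 : ℝ) 1)
      (f := fun t => fun i => ‖b' i t‖) (continuous_pi fun i => (hb' i).norm).continuousOn
    refine ⟨C, fun t ht i => ?_⟩
    have := (norm_le_pi_norm (fun i => ‖b' i t‖) i).trans (hC t ht)
    rwa [norm_norm] at this
  rw [Submodule.span_le]
  rintro _ ⟨j, rfl⟩
  by_contra hj
  -- A functional vanishing on the span at time `0` but not on `b j 1`. The vector `u = (φ (b i))`
  -- satisfies `‖u'‖ ≤ K ‖u‖` and `u 0 = 0`, hence vanishes on `[0, 1]` by Grönwall, a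
  -- contradiction.
  obtain ⟨φ₀, hφj, hφ⟩ := Submodule.exists_le_ker_of_notMem hj
  let φ : W →L[ℝ] ℝ := LinearMap.toContinuousLinearMap φ₀
  have hu : ∀ t, HasDerivAt (fun t => fun i => φ (b i t)) (fun i => φ (b' i t)) t := fun t =>
    hasDerivAt_pi.2 fun i => φ.hasFDerivAt.comp_hasDerivAt t (hb i t)
  have hu0 : (fun i => φ (b i 0)) = 0 := funext fun i =>
    hφ (Submodule.subset_span (Set.mem_range_self i))
  have hbound : ∀ t ∈ Set.Icc (0 : ℝ) 1,
      ‖fun i => φ (b' i t)‖ ≤ k * (C / m) * ‖fun i => φ (b i t)‖ := by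
    intro t ht
    have hC0 : ∀ i : Fin k, 0 ≤ C := fun i => (norm_nonneg _).trans (hC t ht i)
    have hcoef : ∀ i, ‖φ (b' i t)‖ ≤ k * (C / m) * ‖fun i => φ (b i t)‖ := by
      intro i
      obtain ⟨c, hc⟩ := (Submodule.mem_span_range_iff_exists_fun ℝ).1 (hmem i t)
      have h1 : ‖c‖ ≤ C / m := by
        rw [le_div_iff₀' hm]
        exact (hmb t ht c).trans (hc ▸ hC t ht i)
      rw [← hc, map_sum]
      refine (norm_sum_le _ _).trans ?_
      have h2 : ∀ l ∈ Finset.univ, ‖φ (c l • b l t)‖ ≤ C / m * ‖fun i => φ (b i t)‖ := by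
        intro l _
        rw [map_smul, norm_smul]
        exact mul_le_mul ((norm_le_pi_norm c l).trans h1)
          (norm_le_pi_norm (fun i => φ (b i t)) l) (norm_nonneg _) (div_nonneg (hC0 i) hm.le)
      refine (Finset.sum_le_card_nsmul _ _ _ h2).trans_eq ?_
      simp [mul_assoc]
    refine (pi_norm_le_iff_of_nonneg ?_).2 hcoef
    exact mul_nonneg (mul_nonneg k.cast_nonneg (div_nonneg (hC0 j) hm.le)) (norm_nonneg _)
  have h0 := eq_zero_of_abs_deriv_le_mul_abs_self_of_eq_zero_right
    (fun t _ => (hu t).continuousAt.continuousWithinAt) (fun t _ => (hu t).hasDerivWithinAt) hu0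
    (fun t ht => hbound t ⟨ht.1, ht.2.le⟩) 1 (by simp)
  exact hφj (congrFun h0 j)

theorem span_le_of_fderiv_mem_span [FiniteDimensional ℝ W] {k : ℕ} {B : Fin k → V → W}
    (hB : ∀ i, ContDiff ℝ 1 (B i)) (hli : ∀ w, LinearIndependent ℝ fun i => B i w) {v : V}
    (hmem : ∀ i w, fderiv ℝ (B i) w v ∈ Submodule.span ℝ (Set.range fun i => B i w)) (w : V) :
    Submodule.span ℝ (Set.range fun i => B i (w + v)) ≤
      Submodule.span ℝ (Set.range fun i => B i w) := by
  have hline : ∀ t : ℝ, HasDerivAt (fun t : ℝ => w + t • v) v t := fun t => by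
    simpa using ((hasDerivAt_id t).smul_const v).const_add w
  have h := span_le_of_deriv_mem_span (b := fun i t => B i (w + t • v))
    (b' := fun i t => fderiv ℝ (B i) (w + t • v) v)
    (fun i t => (((hB i).differentiable (by simp)) _).hasFDerivAt.comp_hasDerivAt t (hline t))
    (fun i => (((hB i).continuous_fderiv (by simp)).comp (by fun_prop)).clm_apply
      continuous_const)
    (fun t => hli _) (fun i t => hmem i _)
  simpa using h

end LinearODE

/-! ### Adapted charts and infinitesimal automorphisms. -/

section Adapted

variable {p q k : ℕ} {M : Type u} [TopologicalSpace M] [ChartedSpace (Model (p + q)) M]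
  [IsManifold (𝓡 (p + q)) ∞ M]
  {F : Foliation p q M} {E : BigSubbundle (p + q) M k}
  {e : OpenPartialHomeomorph M (Model (p + q))}

/-- In an adapted chart the Lie derivative is `∂_Y (X, ξ) + (-dY(X), ξ ∘ dY)`. The first term
differentiates a curve in a single fibre; as `Y` is vertical, so are the values of `dY`, hence
`(dY(X), 0) ∈ E` and `ξ ∘ dY = 0`. -/
theorem HasAdaptedCharts.tangentPreserves (h : HasAdaptedCharts F E) :
    E.TangentPreserves F := by
  intro Y hY hYF X ξ hXξ
  refine ⟨smoothVFieldOn_lieDerivVField hY hXξ.smooth_fst,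
    smoothOneFormOn_lieDerivOneForm hY hXξ.smooth_snd, fun x => ?_⟩
  obtain ⟨e, he, hx, -⟩ := h x Set.univ univ_mem
  have hmem : ∀ w, (chartVField e X w, chartOneForm e ξ w) ∈ chartFiber E.fiber e w := fun w =>
    (chart_mem_chartFiber_iff he.mem (he.mem_target w) E.fiber X ξ).2 (hXξ.mem _)
  have hYv : ∀ w, transProj p q (chartVField e Y w) = 0 := fun w =>
    (he.mem_tangent_iff _ (he.map_target w) _).1 (hYF _)
  have dY := (contDiffAt_chartVField he.mem hY (he.mem_target (e x))).differentiableAt (by simp)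
  have dX := (contDiffAt_chartVField he.mem hXξ.smooth_fst
    (he.mem_target (e x))).differentiableAt (by simp)
  have dξ := (contDiffAt_chartOneForm he.mem hXξ.smooth_snd
    (he.mem_target (e x))).differentiableAt (by simp)
  have hdY : ∀ v, transProj p q (fderiv ℝ (chartVField e Y) (e x) v) = 0 := by
    intro v
    have h1 := ((transProj p q).hasFDerivAt.comp (e x) dY.hasFDerivAt).unique
      ((hasFDerivAt_const (0 : Model q) (e x)).congr_of_eventuallyEq
        (Eventually.of_forall hYv))
    exact congrArg (fun L : Model (p + q) →L[ℝ] Model q => L v) h1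
  have hd : fderiv ℝ (fun w => (chartVField e X w, chartOneForm e ξ w)) (e x)
      (chartVField e Y (e x)) ∈ chartFiber E.fiber e (e x) := by
    refine fderiv_mem_submodule (dX.prodMk dξ) _ fun t => ?_
    rw [← he.chartFiber_eq (w := e x + t • chartVField e Y (e x))
      (by rw [map_add, map_smul, hYv, smul_zero, add_zero])]
    exact hmem _
  rw [dX.fderiv_prodMk dξ] at hd
  have hv := he.vertical_mem (e x) _ (hdY (chartVField e X (e x)))
  have h0 : (chartOneForm e ξ (e x)).comp (fderiv ℝ (chartVField e Y) (e x)) = 0 :=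
    ContinuousLinearMap.ext fun v => he.apply_vertical _ _ (hmem (e x)) _ (hdY v)
  have hfin : (chartVField e (lieDerivVField Y X) (e x),
      chartOneForm e (lieDerivOneForm Y ξ) (e x)) ∈ chartFiber E.fiber e (e x) := by
    rw [chartVField_lieDerivVField he.mem hY hXξ.smooth_fst (he.mem_target _),
      chartOneForm_lieDerivOneForm he.mem hY hXξ.smooth_snd (he.mem_target _)]
    convert Submodule.sub_mem _ hd hv using 1
    refine Prod.ext rfl ?_
    simp only [flatLieOneForm, h0, Prod.snd_sub, sub_zero, add_zero]
    rfl
  have := (chart_mem_chartFiber_iff he.mem (he.mem_target (e x)) E.fiber _ _).1 hfin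
  rwa [e.left_inv hx] at this

/-- Invariance under the vector fields tangent to the leaves, read in a foliated chart. -/
theorem BigSubbundle.TangentPreserves.flat [T2Space M] (h : E.TangentPreserves F)
    (he : IsFoliatedChart F e) {Y X : Model (p + q) → Model (p + q)}
    {ξ : Model (p + q) → (Model (p + q) →L[ℝ] ℝ)} (hY : ContDiff ℝ ∞ Y)
    (hYc : HasCompactSupport Y) (hYv : ∀ w, transProj p q (Y w) = 0)
    (hX : ContDiff ℝ ∞ X) (hXc : HasCompactSupport X) (hξ : ContDiff ℝ ∞ ξ)
    (hξc : HasCompactSupport ξ) (hmem : ∀ w, (X w, ξ w) ∈ chartFiber E.fiber e w)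
    (w : Model (p + q)) :
    (VectorField.lieBracket ℝ Y X w, flatLieOneForm Y ξ w) ∈ chartFiber E.fiber e w := by
  have sY := smoothVFieldOn_extendVField he.mem he.target_eq hY hYc
  have sX := smoothVFieldOn_extendVField he.mem he.target_eq hX hXc
  have sξ := smoothOneFormOn_extendOneForm he.mem he.target_eq hξ hξc
  have eY : chartVField e (extendVField e Y) = Y :=
    funext fun w => chartVField_extendVField he.mem Y (he.mem_target w)
  have eX : chartVField e (extendVField e X) = X :=
    funext fun w => chartVField_extendVField he.mem X (he.mem_target w)
  have eξ : chartOneForm e (extendOneForm e ξ) = ξ :=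
    funext fun w => chartOneForm_extendOneForm he.mem ξ (he.mem_target w)
  have key := h (extendVField e Y) sY (fun x => ?_) (extendVField e X) (extendOneForm e ξ)
    ⟨sX, sξ, fun x => ?_⟩
  · have := (chart_mem_chartFiber_iff he.mem (he.mem_target w) E.fiber _ _).2
      (key.mem (e.symm w))
    rwa [chartVField_lieDerivVField he.mem sY sX (he.mem_target w),
      chartOneForm_lieDerivOneForm he.mem sY sξ (he.mem_target w), eY, eX, eξ] at this
  · by_cases hx : x ∈ e.source
    · have := (he.chartSymmDeriv_mem_tangent_iff (e x) (Y (e x))).2 (hYv _)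
      rw [e.left_inv hx] at this
      rw [extendVField_of_mem hx]
      exact this
    · rw [show extendVField e Y x = 0 from if_neg hx]
      exact Submodule.zero_mem _
  · by_cases hx : x ∈ e.source
    · obtain ⟨w, rfl⟩ : ∃ w, e.symm w = x := ⟨e x, e.left_inv hx⟩
      have := hmem w
      rw [← eX, ← eξ] at this
      exact (chart_mem_chartFiber_iff he.mem (he.mem_target w) E.fiber _ _).1 this
    · rw [show extendVField e X x = 0 from if_neg hx,
        show extendOneForm e ξ x = 0 from if_neg hx]
      exact Submodule.zero_mem _

/-- Invariance is tested on the fields `f v` with `v` a constant vertical vector. The derivative of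
`f` yields the annihilation of vertical vectors, and the value of `f` yields the constancy along the
leaves. -/
theorem BigSubbundle.TangentPreserves.hasAdaptedCharts [T2Space M] (hT : E.ContainsTangent F)
    (h : E.TangentPreserves F)
    (hcot : 0 < p → ∀ x : M, ∃ α : Cotangent (p + q) x, ((0, α) : TBig (p + q) x) ∉ E.fiber x) :
    HasAdaptedCharts F E := by
  intro x₀ W hW
  obtain ⟨U, hU, hx, X, ξ, hframe⟩ := E.exists_frame x₀
  obtain ⟨e, he, hxe, hsub⟩ :=
    exists_isFoliatedChart F x₀ (Filter.inter_mem hW (hU.mem_nhds hx))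
  obtain ⟨B, hB⟩ : ∃ B : Fin k → Model (p + q) → Model (p + q) × (Model (p + q) →L[ℝ] ℝ),
      IsFlatFrame (chartFiber E.fiber e) B :=
    ⟨_, hframe.isFlatFrame he.mem he.target_eq (hsub.trans Set.inter_subset_right)⟩
  have hvert := fun w v => hT.vertical_mem he w v
  have hBmem : ∀ i w, B i w ∈ chartFiber E.fiber e w := fun i w => by
    rw [← hB.span_eq]
    exact Submodule.subset_span (Set.mem_range_self i)
  -- the invariance for `Y = f v`, with `v` vertical, near a given point
  have hinv : ∀ (i : Fin k) (w v : Model (p + q)), transProj p q v = 0 →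
      ∀ f : Model (p + q) → ℝ, ContDiff ℝ ∞ f →
        (f w • (fderiv ℝ (B i) w v) +
          (-(fderiv ℝ f w (B i w).1) • v, (B i w).2 v • fderiv ℝ f w)) ∈
            chartFiber E.fiber e w := by
    intro i w v hv f hf
    -- The cut-off is `1` near `w`, so it makes the fields compactly supported without affecting the
    -- Lie derivatives at `w`.
    let χ : ContDiffBump w := ⟨1, 2, one_pos, one_lt_two⟩
    have hχ : ContDiff ℝ ∞ χ := χ.contDiff
    have hχ1 : ∀ᶠ z in 𝓝 w, χ z = 1 := χ.eventuallyEq_one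
    have key := h.flat he (Y := fun z => χ z • f z • v) (X := fun z => χ z • (B i z).1)
      (ξ := fun z => χ z • (B i z).2) (hχ.smul (hf.smul contDiff_const))
      χ.hasCompactSupport.smul_right (fun z => by simp [map_smul, hv])
      (hχ.smul (hB.contDiff i).fst) χ.hasCompactSupport.smul_right
      (hχ.smul (hB.contDiff i).snd) χ.hasCompactSupport.smul_right
      (fun z => Submodule.smul_mem _ (χ z) (hBmem i z)) w
    have hY1 : (fun z => χ z • f z • v) =ᶠ[𝓝 w] fun z => f z • v :=
      hχ1.mono fun z hz => by simp [hz]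
    have hX1 : (fun z => χ z • (B i z).1) =ᶠ[𝓝 w] fun z => (B i z).1 :=
      hχ1.mono fun z hz => by simp [hz]
    have hξ1 : (fun z => χ z • (B i z).2) =ᶠ[𝓝 w] fun z => (B i z).2 :=
      hχ1.mono fun z hz => by simp [hz]
    rw [hY1.lieBracket_vectorField_eq hX1, flatLieOneForm_congr hY1 hξ1] at key
    have df : DifferentiableAt ℝ f w := hf.differentiable (by simp) w
    have dB : DifferentiableAt ℝ (B i) w := (hB.contDiff i).differentiable (by simp) w
    have e1 : fderiv ℝ (fun z => (B i z).1) w v = (fderiv ℝ (B i) w v).1 := by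
      rw [fderiv.fst dB]
      rfl
    have e2 : fderiv ℝ (fun z => (B i z).2) w v = (fderiv ℝ (B i) w v).2 := by
      rw [fderiv.snd dB]
      rfl
    have e3 : fderiv ℝ (fun z => f z • v) w = (fderiv ℝ f w).smulRight v :=
      fderiv_smul_const df v
    convert key using 1
    refine Prod.ext ?_ ?_
    · simp [VectorField.lieBracket, e1, e3, sub_eq_add_neg]
    · ext u
      simp [flatLieOneForm, e2, e3, mul_comm]
  have happly : ∀ w, ∀ b ∈ chartFiber E.fiber e w, ∀ v, transProj p q v = 0 → b.2 v = 0 := by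
    intro w b hb v hv
    rw [← hB.span_eq, Submodule.mem_span_range_iff_exists_fun] at hb
    obtain ⟨c, rfl⟩ := hb
    rw [Prod.snd_sum, sum_apply]
    refine Finset.sum_eq_zero fun i _ => ?_
    rw [Prod.smul_snd, smul_apply]
    suffices hi : (B i w).2 v = 0 by rw [hi, smul_zero]
    by_contra hne
    -- For `p = 0` the only vertical vector is `0`; otherwise there is a covector outside `E`.
    rcases Nat.eq_zero_or_pos p with rfl | hp
    · refine hne ?_
      have : v = 0 := by
        ext j
        refine Fin.addCases (fun j => j.elim0) (fun j => ?_) j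
        exact (transProj_eq_zero_iff v).1 hv j
      rw [this, map_zero]
    · obtain ⟨α, hα⟩ := hcot hp (e.symm w)
      refine hα ?_
      let α' : Model (p + q) →L[ℝ] ℝ :=
        (show Model (p + q) →L[ℝ] ℝ from α).comp (chartSymmDeriv e w)
      -- This function vanishes at `w` with differential `α'`. Only `(-α'(X) v, ξ(v) α')` remains;
      -- removing the vertical part and dividing by `ξ(v)` puts `(0, α')` in `E`.
      have h1 := hinv i w v hv (fun z => α' (z - w))
        (α'.contDiff.comp (contDiff_id.sub contDiff_const))
      have h2 : fderiv ℝ (fun z => α' (z - w)) w = α' :=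
        (α'.hasFDerivAt.comp w ((hasFDerivAt_id w).sub_const w)).fderiv.trans
          (ContinuousLinearMap.comp_id _)
      rw [h2, sub_self, map_zero, zero_smul, zero_add] at h1
      have h3 := Submodule.smul_mem _ ((B i w).2 v)⁻¹ (Submodule.sub_mem _ h1
        (hvert w (-(α' (B i w).1) • v) (by rw [map_smul, hv, smul_zero])))
      have h4 : ((B i w).2 v)⁻¹ • ((-(α' (B i w).1) • v, (B i w).2 v • α') -
          (-(α' (B i w).1) • v, (0 : Model (p + q) →L[ℝ] ℝ))) = (0, α') := by
        refine Prod.ext (by simp) ?_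
        simp [smul_smul, inv_mul_cancel₀ hne]
      rw [h4] at h3
      have h5 := mem_fiber_iff he.mem (he.map_target w) E.fiber 0 α
      rw [he.right_inv, map_zero] at h5
      exact h5.2 h3
  refine ⟨e, ⟨he, hvert, happly, fun w v hv => ?_⟩, hxe, hsub.trans Set.inter_subset_left⟩
  have hd : ∀ v, transProj p q v = 0 → ∀ i w,
      fderiv ℝ (B i) w v ∈ Submodule.span ℝ (Set.range fun i => B i w) := by
    intro v hv i w
    have := hinv i w v hv (fun _ => 1) contDiff_const
    simp only [fderiv_fun_const, Pi.zero_apply, zero_apply, neg_zero, zero_smul, smul_zero,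
      one_smul] at this
    rw [hB.span_eq]
    convert this using 1
    exact (add_zero _).symm
  -- Going back from `w + v` along `-v` gives the inclusion of the fibre at `w` in the fibre at `w +
  -- v`.
  have hspan := span_le_of_fderiv_mem_span (fun i => (hB.contDiff i).of_le (by simp))
    hB.linearIndependent (hd (-v) (by rw [map_neg, hv, neg_zero])) (w + v)
  rwa [hB.span_eq, hB.span_eq, add_neg_cancel_right] at hspan

end Adapted

end BigFol

theorem proposition5p3 (p q k : ℕ) (M : Type u) [TopologicalSpace M] [T2Space M]
    [ChartedSpace (BigFol.Model (p + q)) M] [IsManifold (𝓡 (p + q)) ∞ M]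
    (F : BigFol.Foliation p q M) (E : BigFol.BigSubbundle (p + q) M k) :
    (E.IsFoliated F ↔ E.ContainsTangent F ∧ E.HasProjectableBases F) ∧
    (E.IsFoliated F → E.ContainsTangent F ∧ E.TangentPreserves F) ∧
    ((0 < p → ∀ x : M, ∃ α : BigFol.Cotangent (p + q) x,
        ((0, α) : BigFol.TBig (p + q) x) ∉ E.fiber x) →
      (E.IsFoliated F ↔ E.ContainsTangent F ∧ E.TangentPreserves F)) := by
  refine ⟨⟨fun h => ?_, fun h => ?_⟩, fun h => ?_, fun hcot => ⟨fun h => ?_, fun h => ?_⟩⟩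
  · exact ⟨h.hasAdaptedCharts.containsTangent, h.hasAdaptedCharts.hasProjectableBases⟩
  · exact (h.2.hasAdaptedCharts h.1).isFoliated
  · exact ⟨h.hasAdaptedCharts.containsTangent, h.hasAdaptedCharts.tangentPreserves⟩
  · exact ⟨h.hasAdaptedCharts.containsTangent, h.hasAdaptedCharts.tangentPreserves⟩
  · exact (h.2.hasAdaptedCharts h.1 hcot).isFoliated
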